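/- Let $\mathcal P(\mathbb Z/4)$ be the additive category of finitely generated projective $\mathbb Z/4$-modules, with the identity functor as translation functor. A pretriangulated structure is a class of exact triangles $A\to B\to C\to A$ satisfying the usual axioms without the octahedral axiom; it is triangulated if the octahedral axiom also holds. (1) $\mathcal P(\mathbb Z/4)$ has exactly one pretriangulated structure, and it satisfies the octahedral axiom. In particular $\mathcal P(\mathbb Z/4)$ has exactly one triangulated structure with the identity as translation functor. (2) A diagram $A\xrightarrow{f}B\xrightarrow{i}C\xrightarrow{q}A$ is an exact triangle of this structure if and only if it is isomorphic to the direct sum of a contractible candidate triangle and a triangle $X\xrightarrow{2}X\xrightarrow{2}X\xrightarrow{2}X$ with $X$ in $\mathcal P(\mathbb Z/4)$. Here a candidate triangle is a diagram as above with $if=0$, $qi=0$, $fq=0$, and it is contractible if its identity morphism is homotopic to zero, that is, if there are morphisms $\alpha_1\colon B\to A$, $\alpha_2\colon C\to B$, $\alpha_0\colon A\to C$ with $$-1_B=f\alpha_1+\alpha_2 i,\qquad -1_C=i\alpha_2+\alpha_0 q,\qquad -1_A=q\alpha_0+\alpha_1 f.$$ (3) In particular $\mathbb Z/4\xrightarrow{2}\mathbb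 Z/4\xrightarrow{2}\mathbb Z/4\xrightarrow{2}\mathbb Z/4$ is an exact triangle. (4) The triangulated category $\mathcal P(\mathbb Z/4)$ is not algebraic: it is not exact equivalent to the stable category of any Frobenius category. That is, there are no Frobenius category $\mathcal E$ (an exact category in the sense of Quillen with enough projectives and enough injectives, in which projectives and injectives coincide), additive equivalence $F$ from $\mathcal P(\mathbb Z/4)$ to the stable category of $\mathcal E$, and natural isomorphism between $F$ and $\Sigma F$, with $\Sigma$ the suspension functor of the stable category, such that $F$ together with this isomorphism sends exact triangles to exact triangles. -/

import Mathlib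

open CategoryTheory CategoryTheory.Limits CategoryTheory.Pretriangulated

universe v u v' u'

noncomputable section

/-! ### Candidate triangles, homotopies, contractible triangles, direct sums -/

namespace TriangleTheory

variable {C : Type u} [Category.{v} C] [Preadditive C] [HasShift C ℤ]

/-- A candidate triangle: consecutive composites in `A ⟶ B ⟶ C ⟶ A⟦1⟧ ⟶ B⟦1⟧` vanish. -/
def IsCandidate (T : Triangle C) : Prop :=
  T.mor₁ ≫ T.mor₂ = 0 ∧ T.mor₂ ≫ T.mor₃ = 0 ∧ T.mor₃ ≫ T.mor₁⟦(1 : ℤ)⟧' = 0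

/-- Two morphisms `k k'` of triangles are homotopic. -/
def Homotopic {T T' : Triangle C} (k k' : T ⟶ T') : Prop :=
  ∃ (α₁ : T.obj₂ ⟶ T'.obj₁) (α₂ : T.obj₃ ⟶ T'.obj₂) (α₀ : T.obj₁⟦(1 : ℤ)⟧ ⟶ T'.obj₃),
    -k.hom₂ + k'.hom₂ = α₁ ≫ T'.mor₁ + T.mor₂ ≫ α₂ ∧
    -k.hom₃ + k'.hom₃ = α₂ ≫ T'.mor₂ + T.mor₃ ≫ α₀ ∧
    -k.hom₁⟦(1 : ℤ)⟧' + k'.hom₁⟦(1 : ℤ)⟧' = α₀ ≫ T'.mor₃ + (T.mor₁ ≫ α₁)⟦(1 : ℤ)⟧'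

variable [∀ n : ℤ, (shiftFunctor C n).Additive]

/-- A contractible candidate triangle: the identity is homotopic to zero. -/
def IsContractible (T : Triangle C) : Prop :=
  IsCandidate T ∧ Homotopic (𝟙 T) (0 : T ⟶ T)

/-- The direct sum of two triangles. -/
def directSum [HasBinaryBiproducts C] (T T' : Triangle C) : Triangle C :=
  Triangle.mk (biprod.map T.mor₁ T'.mor₁) (biprod.map T.mor₂ T'.mor₂)
    (biprod.desc (T.mor₃ ≫ (biprod.inl : T.obj₁ ⟶ T.obj₁ ⊞ T'.obj₁)⟦(1 : ℤ)⟧')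
      (T'.mor₃ ≫ (biprod.inr : T'.obj₁ ⟶ T.obj₁ ⊞ T'.obj₁)⟦(1 : ℤ)⟧'))

end TriangleTheory

/-! ### Frobenius exact categories and their stable categories -/

section Exact

variable {E : Type u} [Category.{v} E] [Preadditive E]

/-- Inflations (admissible monomorphisms) for a class of short complexes. -/
def IsInflation (P : ShortComplex E → Prop) {X Y : E} (f : X ⟶ Y) : Prop :=
  ∃ (Z : E) (g : Y ⟶ Z) (w : f ≫ g = 0), P (ShortComplex.mk f g w)

/-- Deflations (admissible epimorphisms) for a class of short complexes. -/
def IsDeflation (P : ShortComplex E → Prop) {Y Z : E} (g : Y ⟶ Z) : Prop :=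
  ∃ (X : E) (f : X ⟶ Y) (w : f ≫ g = 0), P (ShortComplex.mk f g w)

variable (E) in
/-- A Quillen exact structure on an additive category `E`: a class of kernel-cokernel pairs
(the conflations), closed under isomorphism, such that identities are inflations and deflations,
inflations (deflations) are closed under composition, and pushouts of inflations (pullbacks of
deflations) along arbitrary morphisms exist and are inflations (deflations). -/
structure ExactStructure [HasZeroObject E] [HasBinaryBiproducts E] where
  IsConflation : ShortComplex E → Prop
  isKernel : ∀ S, IsConflation S → Nonempty (IsLimit (KernelFork.ofι S.f S.zero))
  isCokernel : ∀ S, IsConflation S → Nonempty (IsColimit (CokernelCofork.ofπ S.g S.zero))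
  of_iso : ∀ S S', Nonempty (S ≅ S') → IsConflation S → IsConflation S'
  inflation_id : ∀ X : E, IsInflation IsConflation (𝟙 X)
  deflation_id : ∀ X : E, IsDeflation IsConflation (𝟙 X)
  inflation_comp : ∀ {X Y Z : E} (f : X ⟶ Y) (g : Y ⟶ Z),
    IsInflation IsConflation f → IsInflation IsConflation g → IsInflation IsConflation (f ≫ g)
  deflation_comp : ∀ {X Y Z : E} (f : X ⟶ Y) (g : Y ⟶ Z),
    IsDeflation IsConflation f → IsDeflation IsConflation g → IsDeflation IsConflation (f ≫ g)
  pushout : ∀ {X Y X' : E} (f : X ⟶ Y) (a : X ⟶ X'), IsInflation IsConflation f →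
    ∃ (Y' : E) (b : Y ⟶ Y') (f' : X' ⟶ Y'), IsPushout f a b f' ∧ IsInflation IsConflation f'
  pullback : ∀ {Y Z Z' : E} (g : Y ⟶ Z) (c : Z' ⟶ Z), IsDeflation IsConflation g →
    ∃ (Y' : E) (b : Y' ⟶ Y) (g' : Y' ⟶ Z'), IsPullback b g' g c ∧ IsDeflation IsConflation g'

variable [HasZeroObject E] [HasBinaryBiproducts E]

namespace ExactStructure

/-- Injective objects relative to the exact structure. -/
def IsInjective (S : ExactStructure E) (J : E) : Prop :=
  ∀ T, S.IsConflation T → ∀ a : T.X₁ ⟶ J, ∃ b : T.X₂ ⟶ J, T.f ≫ b = a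

/-- Projective objects relative to the exact structure. -/
def IsProjective (S : ExactStructure E) (P : E) : Prop :=
  ∀ T, S.IsConflation T → ∀ a : P ⟶ T.X₃, ∃ b : P ⟶ T.X₂, b ≫ T.g = a

lemma IsInjective.biprod {S : ExactStructure E} {J K : E} (hJ : S.IsInjective J)
    (hK : S.IsInjective K) : S.IsInjective (J ⊞ K) := by
  intro T hT a
  obtain ⟨b, hb⟩ := hJ T hT (a ≫ biprod.fst)
  obtain ⟨c, hc⟩ := hK T hT (a ≫ biprod.snd)
  exact ⟨biprod.lift b c, by ext <;> simp [hb, hc]⟩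

end ExactStructure

variable (E) in
/-- A Frobenius category: an exact category with enough projectives and enough injectives
in which the projective objects and the injective objects are the same. -/
structure FrobeniusStructure extends ExactStructure E where
  enough_injectives : ∀ X : E, ∃ (J Z : E) (i : X ⟶ J) (p : J ⟶ Z) (w : i ≫ p = 0),
    IsConflation (ShortComplex.mk i p w) ∧ toExactStructure.IsInjective J
  enough_projectives : ∀ X : E, ∃ (K P : E) (i : K ⟶ P) (p : P ⟶ X) (w : i ≫ p = 0),
    IsConflation (ShortComplex.mk i p w) ∧ toExactStructure.IsProjective P
  projective_iff_injective : ∀ X : E,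
    toExactStructure.IsProjective X ↔ toExactStructure.IsInjective X

namespace FrobeniusStructure

variable (S : FrobeniusStructure E)

/-- Two parallel morphisms are identified in the stable category when their difference factors
through an injective object. -/
def stableRel : HomRel E := fun X Y f g =>
  ∃ (J : E) (_ : S.IsInjective J) (p : X ⟶ J) (q : J ⟶ Y), f - g = p ≫ q

lemma stableRel_add {X Y : E} {f₁ f₂ g₁ g₂ : X ⟶ Y} (hf : S.stableRel f₁ f₂)
    (hg : S.stableRel g₁ g₂) : S.stableRel (f₁ + g₁) (f₂ + g₂) := by
  obtain ⟨J, hJ, p, q, h⟩ := hf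
  obtain ⟨K, hK, p', q', h'⟩ := hg
  exact ⟨J ⊞ K, hJ.biprod hK, biprod.lift p p', biprod.desc q q', by
    rw [biprod.lift_desc, ← h, ← h']; abel⟩

lemma exists_injective (X : E) : ∃ J : E, S.IsInjective J := by
  obtain ⟨J, -, -, -, -, -, h⟩ := S.enough_injectives X
  exact ⟨J, h⟩

instance : Congruence S.stableRel where
  comp_left f g g' h := by
    obtain ⟨J, hJ, p, q, h⟩ := h
    exact ⟨J, hJ, f ≫ p, q, by rw [← Preadditive.comp_sub, h, Category.assoc]⟩
  comp_right g h := by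
    obtain ⟨J, hJ, p, q, h⟩ := h
    exact ⟨J, hJ, p, q ≫ g, by rw [← Preadditive.sub_comp, h, Category.assoc]⟩
  equivalence {X Y} :=
    { refl := fun f => by
        obtain ⟨J, hJ⟩ := S.exists_injective X
        exact ⟨J, hJ, 0, 0, by simp⟩
      symm := fun ⟨J, hJ, p, q, h⟩ => ⟨J, hJ, -p, q, by rw [Preadditive.neg_comp, ← h]; abel⟩
      trans := fun {f g k} h h' => by
        obtain ⟨J, hJ, p, q, h⟩ := h
        obtain ⟨K, hK, p', q', h'⟩ := h'
        exact ⟨J ⊞ K, hJ.biprod hK, biprod.lift p p', biprod.desc q q', by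
          rw [biprod.lift_desc, ← h, ← h']; abel⟩ }

/-- The stable category: the quotient of `E` by the morphisms that factor through an injective
object. -/
abbrev Stable : Type u := CategoryTheory.Quotient S.stableRel

/-- The projection to the stable category. -/
abbrev toStable : E ⥤ S.Stable := CategoryTheory.Quotient.functor S.stableRel

instance : Preadditive S.Stable :=
  CategoryTheory.Quotient.preadditive S.stableRel fun _ _ _ _ _ _ hf hg => S.stableRel_add hf hg

/-- A chosen injective object containing `X`. -/
def hull (X : E) : E := (S.enough_injectives X).choose

/-- The suspension of `X`, the cokernel of the inclusion of `X` in its chosen injective. -/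
def susp (X : E) : E := (S.enough_injectives X).choose_spec.choose

/-- The chosen inflation from `X` to an injective object. -/
def ι (X : E) : X ⟶ S.hull X := (S.enough_injectives X).choose_spec.choose_spec.choose

/-- The chosen deflation onto the suspension. -/
def π (X : E) : S.hull X ⟶ S.susp X :=
  (S.enough_injectives X).choose_spec.choose_spec.choose_spec.choose

lemma ι_π (X : E) : S.ι X ≫ S.π X = 0 :=
  (S.enough_injectives X).choose_spec.choose_spec.choose_spec.choose_spec.choose

lemma conflation_ι_π (X : E) : S.IsConflation (ShortComplex.mk (S.ι X) (S.π X) (S.ι_π X)) :=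
  (S.enough_injectives X).choose_spec.choose_spec.choose_spec.choose_spec.choose_spec.1

lemma injective_hull (X : E) : S.IsInjective (S.hull X) :=
  (S.enough_injectives X).choose_spec.choose_spec.choose_spec.choose_spec.choose_spec.2

lemma exists_desc {X W : E} (k : S.hull X ⟶ W) (hk : S.ι X ≫ k = 0) :
    ∃ s : S.susp X ⟶ W, S.π X ≫ s = k := by
  obtain ⟨h⟩ := S.isCokernel _ (S.conflation_ι_π X)
  exact ⟨h.desc (CokernelCofork.ofπ k hk), h.fac _ WalkingParallelPair.one⟩

lemma π_cancel {X W : E} {s t : S.susp X ⟶ W} (h : S.π X ≫ s = S.π X ≫ t) : s = t := by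
  obtain ⟨hc⟩ := S.isCokernel _ (S.conflation_ι_π X)
  exact Cofork.IsColimit.hom_ext hc h

/-- `g : susp X ⟶ susp Y` is induced by `f : X ⟶ Y` through some extension of `f` to the chosen
injective objects. -/
def Induces {X Y : E} (f : X ⟶ Y) (g : S.susp X ⟶ S.susp Y) : Prop :=
  ∃ e : S.hull X ⟶ S.hull Y, S.ι X ≫ e = f ≫ S.ι Y ∧ S.π X ≫ g = e ≫ S.π Y

lemma exists_induces {X Y : E} (f : X ⟶ Y) : ∃ g, S.Induces f g := by
  obtain ⟨e, he⟩ := S.injective_hull Y _ (S.conflation_ι_π X) (f ≫ S.ι Y)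
  obtain ⟨g, hg⟩ := S.exists_desc (e ≫ S.π Y) (by
    have he' : S.ι X ≫ e = f ≫ S.ι Y := he
    rw [← Category.assoc, he', Category.assoc, S.ι_π, comp_zero])
  exact ⟨g, e, he, hg⟩

lemma Induces.stableRel {X Y : E} {f f' : X ⟶ Y} {g g' : S.susp X ⟶ S.susp Y}
    (h : S.Induces f g) (h' : S.Induces f' g') (hf : S.stableRel f f') : S.stableRel g g' := by
  obtain ⟨e, he, hg⟩ := h
  obtain ⟨e', he', hg'⟩ := h'
  obtain ⟨J, hJ, p, q, hpq⟩ := hf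
  obtain ⟨r, hr⟩ := hJ _ (S.conflation_ι_π X) p
  have hr' : S.ι X ≫ r = p := hr
  obtain ⟨s, hs⟩ := S.exists_desc (e - e' - r ≫ q ≫ S.ι Y) (by
    rw [Preadditive.comp_sub, Preadditive.comp_sub, he, he', ← Category.assoc, hr',
      ← Category.assoc, ← hpq, Preadditive.sub_comp, sub_self])
  refine ⟨S.hull Y, S.injective_hull Y, s, S.π Y, S.π_cancel ?_⟩
  rw [← Category.assoc, hs]
  simp [Preadditive.comp_sub, Preadditive.sub_comp, hg, hg', S.ι_π]

/-- A morphism of suspensions induced by a morphism, well defined in the stable category. -/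
def suspMap {X Y : E} (f : X ⟶ Y) : S.susp X ⟶ S.susp Y := (S.exists_induces f).choose

lemma induces_suspMap {X Y : E} (f : X ⟶ Y) : S.Induces f (S.suspMap f) :=
  (S.exists_induces f).choose_spec

lemma stableRel_refl {X Y : E} (f : X ⟶ Y) : S.stableRel f f :=
  (Congruence.equivalence (r := S.stableRel)).refl f

/-- The suspension functor of the stable category. -/
def suspension : S.Stable ⥤ S.Stable :=
  CategoryTheory.Quotient.lift S.stableRel
    { obj := fun X => S.toStable.obj (S.susp X)
      map := fun f => S.toStable.map (S.suspMap f)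
      map_id := fun X => by
        rw [← S.toStable.map_id]
        exact CategoryTheory.Quotient.sound _ ((S.induces_suspMap (𝟙 X)).stableRel S
          ⟨𝟙 _, by simp, by simp⟩ (S.stableRel_refl _))
      map_comp := fun {X Y Z} f g => by
        rw [← S.toStable.map_comp]
        obtain ⟨e, he, h⟩ := S.induces_suspMap f
        obtain ⟨e', he', h'⟩ := S.induces_suspMap g
        exact CategoryTheory.Quotient.sound _ ((S.induces_suspMap (f ≫ g)).stableRel S
          ⟨e ≫ e', by rw [← Category.assoc, he, Category.assoc, he', Category.assoc],
            by rw [← Category.assoc, h, Category.assoc, h', Category.assoc]⟩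
          (S.stableRel_refl _)) }
    (fun _ _ f g hfg => CategoryTheory.Quotient.sound _
      ((S.induces_suspMap f).stableRel S (S.induces_suspMap g) hfg))

/-- A standard triangle `X ⟶ Y ⟶ Z ⟶ susp X`: here `Z` is the pushout of `f : X ⟶ Y` and
`X ⟶ hull X`, and `h` is the morphism that is zero on `Y` and the projection on `hull X`. -/
def IsStandard {X Y Z : E} (f : X ⟶ Y) (g : Y ⟶ Z) (h : Z ⟶ S.susp X) : Prop :=
  ∃ j : S.hull X ⟶ Z, IsPushout f (S.ι X) g j ∧ g ≫ h = 0 ∧ j ≫ h = S.π X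

/-- The exact triangles of the stable category: the diagrams isomorphic to the image of a standard
triangle. -/
def IsExactTriangle {A B D : S.Stable} (f : A ⟶ B) (g : B ⟶ D)
    (h : D ⟶ S.suspension.obj A) : Prop :=
  ∃ (X Y Z : E) (f' : X ⟶ Y) (g' : Y ⟶ Z) (h' : Z ⟶ S.susp X) (a : A ≅ S.toStable.obj X)
    (b : B ≅ S.toStable.obj Y) (c : D ≅ S.toStable.obj Z),
    S.IsStandard f' g' h' ∧ f ≫ b.hom = a.hom ≫ S.toStable.map f' ∧
    g ≫ c.hom = b.hom ≫ S.toStable.map g' ∧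
    h ≫ S.suspension.map a.hom = c.hom ≫ S.toStable.map h'

end FrobeniusStructure

end Exact

/-- A pretriangulated category is algebraic when it is exact equivalent to the stable category of
a Frobenius category: there is an additive equivalence which commutes with the translation functors
up to a natural isomorphism and preserves exact triangles. -/
def IsAlgebraicTriangulated (C : Type u) [Category.{v} C] [Preadditive C] [HasZeroObject C] [HasShift C ℤ]
    [∀ n : ℤ, (shiftFunctor C n).Additive] [Pretriangulated C] : Prop :=
  ∃ (E : Type u') (_ : Category.{v'} E) (_ : Preadditive E) (_ : HasZeroObject E)
    (_ : HasBinaryBiproducts E) (S : FrobeniusStructure E) (F : C ≌ S.Stable)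
    (φ : shiftFunctor C (1 : ℤ) ⋙ F.functor ≅ F.functor ⋙ S.suspension),
    F.functor.Additive ∧ ∀ T ∈ distTriang C,
      S.IsExactTriangle (F.functor.map T.mor₁) (F.functor.map T.mor₂)
        (F.functor.map T.mor₃ ≫ φ.hom.app T.obj₁)

/-! ### The category of finitely generated projective modules -/

/-- The property of being a finitely generated projective module. -/
def isFGProjective (R : Type u) [CommRing R] : ObjectProperty (ModuleCat.{u} R) :=
  fun M => Module.Finite R M ∧ Module.Projective R M

/-- The category of finitely generated projective modules over a commutative ring. -/
abbrev FGProj (R : Type u) [CommRing R] := (isFGProjective R).FullSubcategory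

namespace FGProj

variable (R : Type u) [CommRing R]

/-- The free module of rank one. -/
def unit : FGProj R := ⟨ModuleCat.of R R, inferInstanceAs (Module.Finite R R),
  inferInstanceAs (Module.Projective R R)⟩

instance : HasZeroObject (FGProj R) := by
  have : (isFGProjective R).ContainsZero :=
    { exists_zero := ⟨ModuleCat.of R PUnit.{u + 1}, ModuleCat.isZero_of_subsingleton _,
        inferInstanceAs (Module.Finite R PUnit.{u + 1}),
        inferInstanceAs (Module.Projective R PUnit.{u + 1})⟩ }
  infer_instance

instance : HasBinaryBiproducts (FGProj R) where
  has_binary_biproduct X Y := by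
    have := X.property.1
    have := X.property.2
    have := Y.property.1
    have := Y.property.2
    exact hasBinaryBiproduct_of_total
      { pt := ⟨ModuleCat.of R (X.obj × Y.obj), inferInstanceAs (Module.Finite R (X.obj × Y.obj)),
          inferInstanceAs (Module.Projective R (X.obj × Y.obj))⟩
        fst := ObjectProperty.homMk (ModuleCat.ofHom (LinearMap.fst R X.obj Y.obj))
        snd := ObjectProperty.homMk (ModuleCat.ofHom (LinearMap.snd R X.obj Y.obj))
        inl := ObjectProperty.homMk (ModuleCat.ofHom (LinearMap.inl R X.obj Y.obj))
        inr := ObjectProperty.homMk (ModuleCat.ofHom (LinearMap.inr R X.obj Y.obj)) }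
      (by
        apply ObjectProperty.hom_ext
        apply ModuleCat.hom_ext
        apply LinearMap.ext
        rintro ⟨x, y⟩
        change ((x, 0) + (0, y) : X.obj × Y.obj) = (x, y)
        simp)

/-- The identity functor as translation functor (every shift functor is the identity). -/
instance : HasShift (FGProj R) ℤ :=
  hasShiftMk _ _
    { F := fun _ => 𝟭 _
      zero := Iso.refl _
      add := fun _ _ => (Functor.leftUnitor _).symm }

instance (n : ℤ) : (shiftFunctor (FGProj R) n).Additive :=
  inferInstanceAs (𝟭 (FGProj R)).Additive

variable {R}

/-- The triangle `X ⟶ X ⟶ X ⟶ X` all of whose morphisms are multiplication by `2`. -/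
def twoTriangle (X : FGProj R) : Triangle (FGProj R) :=
  Triangle.mk ((2 : ℤ) • 𝟙 X) ((2 : ℤ) • 𝟙 X) ((2 : ℤ) • 𝟙 X : X ⟶ (𝟭 (FGProj R)).obj X)

end FGProj

end

/-! The exact triangles are characterised by `IsGood`: the sequence `A → B → C → A → B` is exact,
and every partial morphism into it from the triangle `2, 2, 2` on `ZMod 4` extends. Throughout, an
element of a projective module killed by 2 is divisible by 2 (`exists_eq_two_smul`).

Existence. Every map of finitely generated projectives is a sum of an isomorphism, a zero map and a
multiplication by 2 (`exists_normal_form`), so it starts a sum of a contractible triangle and a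
triangle of 2s. A commutative square from such a sum to a good triangle can be completed: exactness
suffices on the contractible part, and the extension property is what the other part needs
(`exists_fill_normal`). If the given components are isomorphisms, so is the third, by the five
lemma. Hence the good triangles are exactly these sums, and their morphisms can be completed.

Octahedral axiom. A completion of a morphism that is the identity on first objects is modified until
its Mayer-Vietoris triangle is good (`exists_isGood_mayerVietoris`). Using this twice gives the
octahedron.

Uniqueness. In any pretriangulated structure the cone of 2 on `ZMod 4` is forced to be `ZMod 4` with
maps 2. Completing morphisms out of this triangle shows that exact triangles are good; conversely a
good triangle is isomorphic, by completion and the five lemma, to an exact one on the same first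
map.

Not algebraic. In the stable category of a Frobenius category the cone `Z` of 2 on any object
satisfies `2 • 𝟙 Z = 0`. A projective module over `ZMod 4` with this property is zero, so under an
equivalence the cone of 2 on `ZMod 4` would vanish. Since 2 is itself killed by 2, it factors
through that cone, giving 2 = 0, which is false. This obstructs even an additive equivalence. -/

noncomputable section

/-! ### Linear algebra over `ZMod 4` -/

namespace ZModFour

section

variable {A B C : Type*} [AddCommGroup A] [Module (ZMod 4) A] [AddCommGroup B]
  [Module (ZMod 4) B] [AddCommGroup C] [Module (ZMod 4) C]

lemma four_smul (a : A) : (4 : ZMod 4) • a = 0 := by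
  rw [show (4 : ZMod 4) = 0 from rfl, zero_smul]

lemma two_smul_two_smul (a : A) : (2 : ZMod 4) • (2 : ZMod 4) • a = 0 := by
  rw [smul_smul, show (2 * 2 : ZMod 4) = 0 from rfl, zero_smul]

lemma neg_two_smul' (a : A) : -((2 : ZMod 4) • a) = (2 : ZMod 4) • a := by
  linear_combination (norm := module) -four_smul a

variable (C) in
/-- The submodule of the elements divisible by `2`. -/
def doubles : Submodule (ZMod 4) C := LinearMap.range (LinearMap.lsmul (ZMod 4) C 2)

lemma mem_doubles {c : C} : c ∈ doubles C ↔ ∃ b, c = (2 : ZMod 4) • b :=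
  ⟨fun ⟨b, hb⟩ => ⟨b, hb.symm⟩, fun ⟨b, hb⟩ => ⟨b, hb.symm⟩⟩

/-- In a projective module the elements killed by `2` are divisible by `2`. -/
lemma exists_eq_two_smul [Module.Projective (ZMod 4) C] {c : C} (hc : (2 : ZMod 4) • c = 0) :
    ∃ b, c = (2 : ZMod 4) • b := by
  obtain ⟨s, hs⟩ := Module.projective_def'.1 ‹Module.Projective (ZMod 4) C›
  -- A set-theoretic choice of half, applied to the coordinates in a free module that contains `C`
  -- as a retract; `half 0 = 0` preserves finite support.
  let half : ZMod 4 → ZMod 4 := fun z => if z = 2 then 1 else 0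
  have h0 : half 0 = 0 := rfl
  have key : ∀ z : ZMod 4, 2 * z = 0 → z = 2 * half z := by decide
  have h1 : s c = (2 : ZMod 4) • (s c).mapRange half h0 := by
    ext x
    have h2 := DFunLike.congr_fun (congrArg s hc) x
    simp only [map_smul, Finsupp.smul_apply, smul_eq_mul, map_zero, Finsupp.coe_zero,
      Pi.zero_apply] at h2
    rw [Finsupp.smul_apply, Finsupp.mapRange_apply]
    exact key _ h2
  refine ⟨Finsupp.linearCombination (ZMod 4) id ((s c).mapRange half h0), ?_⟩
  rw [← map_smul, ← h1]
  exact (LinearMap.congr_fun hs c).symm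

/-- A total linear relation out of a projective module contains the graph of a linear map. -/
lemma exists_linear_selection [Module.Projective (ZMod 4) B] (L : Submodule (ZMod 4) (B × C))
    (hL : ∀ b, ∃ c, (b, c) ∈ L) : ∃ m : B →ₗ[ZMod 4] C, ∀ b, (b, m b) ∈ L := by
  obtain ⟨h, hh⟩ := Module.projective_lifting_property
    ((LinearMap.fst (ZMod 4) B C).comp L.subtype) LinearMap.id (fun b => by
      obtain ⟨c, hc⟩ := hL b
      exact ⟨⟨_, hc⟩, rfl⟩)
  refine ⟨(LinearMap.snd (ZMod 4) B C).comp (L.subtype.comp h), fun b => ?_⟩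
  have : (h b : B × C).1 = b := LinearMap.congr_fun hh b
  have h2 : (b, (h b : B × C).2) = (h b : B × C) := Prod.ext this.symm rfl
  exact h2 ▸ (h b).2

/-- Lifting through an affine-linear condition. -/
lemma exists_linear_of_forall {E : Type*} [AddCommGroup E] [Module (ZMod 4) E]
    [Module.Projective (ZMod 4) B] (φ : B →ₗ[ZMod 4] E) (ψ : C →ₗ[ZMod 4] E)
    (N : Submodule (ZMod 4) E) (h : ∀ b, ∃ c, φ b - ψ c ∈ N) :
    ∃ m : B →ₗ[ZMod 4] C, ∀ b, φ b - ψ (m b) ∈ N :=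
  exists_linear_selection (N.comap (φ.comp (LinearMap.fst _ _ _) - ψ.comp (LinearMap.snd _ _ _))) h

/-- A submodule containing the doubles is, modulo doubles, the image of an endomorphism that
is the identity on it. -/
lemma exists_approx_projection [Module.Projective (ZMod 4) C] (D : Submodule (ZMod 4) C)
    (hD : doubles C ≤ D) : ∃ ε : C →ₗ[ZMod 4] C, (∀ c, ε c ∈ D) ∧ ∀ d ∈ D, d - ε d ∈ doubles C := by
  let V := C ⧸ doubles C
  have hV : ∀ x : V, 2 • x = 0 := by
    intro x
    obtain ⟨c, rfl⟩ := Submodule.Quotient.mk_surjective _ x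
    rw [← Submodule.Quotient.mk_smul, Submodule.Quotient.mk_eq_zero]
    exact ⟨c, by simp [two_smul]⟩
  -- `C` modulo doubles is a vector space over the field `ZMod 2`, so the image of `D` is a retract.
  -- The retraction lifts to `C` by projectivity, and the lift lands in `D` because `D` contains the
  -- doubles.
  let _ : Module (ZMod 2) V := AddCommGroup.zmodModule hV
  let U : Submodule (ZMod 2) V :=
    AddSubgroup.toZModSubmodule 2 (D.map (doubles C).mkQ).toAddSubgroup
  obtain ⟨g, hg⟩ := U.subtype.exists_leftInverse_of_injective U.ker_subtype
  let e : V →ₗ[ZMod 4] V := (U.subtype.comp g).toAddMonoidHom.toZModLinearMap 4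
  obtain ⟨ε, hε⟩ := Module.projective_lifting_property (doubles C).mkQ
    (e.comp (doubles C).mkQ) (Submodule.mkQ_surjective _)
  have hε' : ∀ c, (doubles C).mkQ (ε c) = g ((doubles C).mkQ c) := LinearMap.congr_fun hε
  refine ⟨ε, fun c => ?_, fun d hd => ?_⟩
  · have h1 : (doubles C).mkQ (ε c) ∈ D.map (doubles C).mkQ := by
      rw [hε']
      exact (g ((doubles C).mkQ c)).2
    obtain ⟨d, hd, h⟩ := h1
    have := hD ((Submodule.Quotient.eq _).1 h)
    simpa using D.sub_mem hd this
  · refine (Submodule.Quotient.eq _).1 ?_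
    have h1 : (doubles C).mkQ d ∈ U := ⟨d, hd, rfl⟩
    exact ((hε' d).trans (congrArg Subtype.val (LinearMap.congr_fun hg ⟨_, h1⟩))).symm

/-- If `ε` and `η` project onto `D` and `N` modulo doubles, then `(1 - η) ε` is, modulo doubles, a
projection of `D` onto a complement of `N`. -/
lemma exists_approx_projection_of_le [Module.Projective (ZMod 4) C] (N D : Submodule (ZMod 4) C)
    (hN : doubles C ≤ N) (hND : N ≤ D) : ∃ ε : C →ₗ[ZMod 4] C, (∀ c, ε c ∈ D) ∧
      (∀ c ∈ N, ε c ∈ doubles C) ∧ ∀ d ∈ D, d - ε d ∈ N := by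
  obtain ⟨ε, h1, h2⟩ := exists_approx_projection D (hN.trans hND)
  obtain ⟨η, h3, h4⟩ := exists_approx_projection N hN
  refine ⟨ε - η.comp ε, fun c => D.sub_mem (h1 c) (hND (h3 _)), fun c hc => ?_, fun d hd => ?_⟩
  · refine h4 _ ?_
    have := N.sub_mem hc (hN (h2 c (hND hc)))
    simpa using this
  · have := N.add_mem (hN (h2 d hd)) (h3 (ε d))
    simpa [sub_add] using this

end

/-! ### Good triangles and their rotations -/

section

variable {A B C A' B' C' : Type*}
  [AddCommGroup A'] [Module (ZMod 4) A'] [AddCommGroup B'] [Module (ZMod 4) B']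
  [AddCommGroup C'] [Module (ZMod 4) C'] [AddCommGroup A] [Module (ZMod 4) A]
  [AddCommGroup B] [Module (ZMod 4) B] [AddCommGroup C] [Module (ZMod 4) C]

/-- The sequence `A → B → C → A → B` is exact. -/
structure IsQuasiExact (f : A →ₗ[ZMod 4] B) (i : B →ₗ[ZMod 4] C) (q : C →ₗ[ZMod 4] A) : Prop where
  exact₁ : Function.Exact f i
  exact₂ : Function.Exact i q
  exact₃ : Function.Exact q f

/-- A quasi-exact sequence to which every partial morphism from the sequence with all three terms
`ZMod 4` and all three maps multiplication by `2` extends. -/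
structure IsGood (f : A →ₗ[ZMod 4] B) (i : B →ₗ[ZMod 4] C) (q : C →ₗ[ZMod 4] A) : Prop
    extends IsQuasiExact f i q where
  extend : ∀ x y, f x = (2 : ZMod 4) • y → ∃ z, i y = (2 : ZMod 4) • z ∧ q z = (2 : ZMod 4) • x

namespace IsQuasiExact

variable {f : A →ₗ[ZMod 4] B} {i : B →ₗ[ZMod 4] C} {q : C →ₗ[ZMod 4] A}
  {f' : A' →ₗ[ZMod 4] B'} {i' : B' →ₗ[ZMod 4] C'} {q' : C' →ₗ[ZMod 4] A'}

lemma rotate (h : IsQuasiExact f i q) : IsQuasiExact i q (-f) where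
  exact₁ := h.exact₂
  exact₂ := fun a => by simpa using h.exact₃ a
  exact₃ := fun b => by
    rw [h.exact₁ b]
    constructor
    · rintro ⟨a, rfl⟩
      exact ⟨-a, by simp⟩
    · rintro ⟨a, rfl⟩
      exact ⟨-a, by simp⟩

/-- The five lemma. -/
lemma bijective (h : IsQuasiExact f i q) (h' : IsQuasiExact f' i' q') {a : A →ₗ[ZMod 4] A'}
    {b : B →ₗ[ZMod 4] B'} {c : C →ₗ[ZMod 4] C'} (h₁ : ∀ x, b (f x) = f' (a x))
    (h₂ : ∀ y, c (i y) = i' (b y)) (h₃ : ∀ z, a (q z) = q' (c z)) (ha : Function.Bijective a)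
    (hb : Function.Bijective b) : Function.Bijective c :=
  LinearMap.bijective_of_surjective_of_bijective_of_bijective_of_injective f i q f f' i' q' f'
    a b c a b (LinearMap.ext fun x => (h₁ x).symm) (LinearMap.ext fun x => (h₂ x).symm)
    (LinearMap.ext fun x => (h₃ x).symm) (LinearMap.ext fun x => (h₁ x).symm)
    h.exact₁ h.exact₂ h.exact₃ h'.exact₁ h'.exact₂ h'.exact₃ ha.2 hb ha hb.1

end IsQuasiExact

namespace IsGood

variable {f : A →ₗ[ZMod 4] B} {i : B →ₗ[ZMod 4] C} {q : C →ₗ[ZMod 4] A}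
  {f' : A' →ₗ[ZMod 4] B'} {i' : B' →ₗ[ZMod 4] C'} {q' : C' →ₗ[ZMod 4] A'}

lemma of_equiv (h : IsGood f i q) (a : A ≃ₗ[ZMod 4] A') (b : B ≃ₗ[ZMod 4] B')
    (c : C ≃ₗ[ZMod 4] C') (h₁ : ∀ x, b (f x) = f' (a x)) (h₂ : ∀ y, c (i y) = i' (b y))
    (h₃ : ∀ z, a (q z) = q' (c z)) : IsGood f' i' q' where
  exact₁ := Function.Exact.of_ladder_linearEquiv_of_exact (LinearMap.ext fun x => (h₁ x).symm)
    (LinearMap.ext fun x => (h₂ x).symm) h.exact₁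
  exact₂ := Function.Exact.of_ladder_linearEquiv_of_exact (LinearMap.ext fun x => (h₂ x).symm)
    (LinearMap.ext fun x => (h₃ x).symm) h.exact₂
  exact₃ := Function.Exact.of_ladder_linearEquiv_of_exact (LinearMap.ext fun x => (h₃ x).symm)
    (LinearMap.ext fun x => (h₁ x).symm) h.exact₃
  extend x y hxy := by
    obtain ⟨z, hz, hz'⟩ := h.extend (a.symm x) (b.symm y) (b.injective (by
      rw [h₁, a.apply_symm_apply, hxy, map_smul, b.apply_symm_apply]))
    refine ⟨c z, ?_, ?_⟩
    · rw [← map_smul, ← hz, h₂, b.apply_symm_apply]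
    · rw [← h₃, hz', map_smul, a.apply_symm_apply]

/-- Divisibility by 2 gives some partial morphism `(x₀, y₀)` with `q z = 2 x₀`. Its extension `z₀`
differs from `z` by an element of the image of `i`, and the error is absorbed by adding `2 a` to
`x₀`. The sign of `-f` is harmless since `-2 = 2`. -/
lemma rotate [Module.Projective (ZMod 4) A] [Module.Projective (ZMod 4) B]
    (h : IsGood f i q) : IsGood i q (-f) where
  toIsQuasiExact := h.toIsQuasiExact.rotate
  extend y z hyz := by
    obtain ⟨x₀, hx₀⟩ := exists_eq_two_smul (c := q z) (by
      rw [← map_smul, ← hyz, h.exact₂.apply_apply_eq_zero])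
    obtain ⟨y₀, hy₀⟩ := exists_eq_two_smul (c := f x₀) (by
      rw [← map_smul, ← hx₀, h.exact₃.apply_apply_eq_zero])
    obtain ⟨z₀, hz₀, hz₀'⟩ := h.extend x₀ y₀ hy₀
    obtain ⟨b, hb⟩ := (h.exact₂ (z - z₀)).1 (by rw [map_sub, hx₀, hz₀', sub_self])
    obtain ⟨a, ha⟩ := (h.exact₁ (y - y₀ - (2 : ZMod 4) • b)).1 (by
      rw [map_sub, map_sub, map_smul, hb, hyz, hz₀]
      module)
    refine ⟨x₀ + (2 : ZMod 4) • a, ?_, ?_⟩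
    · rw [hx₀, smul_add, two_smul_two_smul, add_zero]
    · rw [LinearMap.neg_apply, map_add, map_smul, ha, hy₀]
      linear_combination (norm := module) -four_smul y + four_smul b

lemma exact_of_neg {f : A →ₗ[ZMod 4] B} {i : B →ₗ[ZMod 4] C}
    (h : Function.Exact (-f : A →ₗ[ZMod 4] B) (-i : B →ₗ[ZMod 4] C)) : Function.Exact f i := by
  intro y
  have hy := h y
  rw [LinearMap.neg_apply, neg_eq_zero] at hy
  rw [hy]
  constructor <;> rintro ⟨a, rfl⟩ <;> exact ⟨-a, by simp⟩

lemma of_neg (h : IsGood (-f) (-i) (-q)) : IsGood f i q where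
  exact₁ := exact_of_neg h.exact₁
  exact₂ := exact_of_neg h.exact₂
  exact₃ := exact_of_neg h.exact₃
  extend x y hxy := by
    obtain ⟨z, hz, hz'⟩ := h.extend x y (by rw [LinearMap.neg_apply, hxy, neg_two_smul'])
    refine ⟨z, ?_, ?_⟩
    · rw [← neg_two_smul', ← hz, LinearMap.neg_apply, neg_neg]
    · rw [← neg_two_smul', ← hz', LinearMap.neg_apply, neg_neg]

/-- Three rotations negate all three maps, and `of_neg` removes the signs. -/
lemma rotate_iff [Module.Projective (ZMod 4) A] [Module.Projective (ZMod 4) B]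
    [Module.Projective (ZMod 4) C] : IsGood i q (-f) ↔ IsGood f i q :=
  ⟨fun h => of_neg h.rotate.rotate, rotate⟩

end IsGood
end

end ZModFour

/-- The object of `FGProj R` given by a finitely generated projective module. -/
def FGProj.of (R : Type u) [CommRing R] (M : Type u) [AddCommGroup M] [Module R M]
    [h₁ : Module.Finite R M] [h₂ : Module.Projective R M] : FGProj R :=
  ⟨ModuleCat.of R M, h₁, h₂⟩

instance (R : Type u) [CommRing R] (X : FGProj R) : Module.Finite R X.obj := X.property.1

instance (R : Type u) [CommRing R] (X : FGProj R) : Module.Projective R X.obj := X.property.2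

namespace ZModFour

/-! ### Normal form of a linear map -/

section

/-- A module is the product of a retract and the kernel of the retraction. -/
def splitEquiv {M P : Type*} [AddCommGroup M] [Module (ZMod 4) M] [AddCommGroup P]
    [Module (ZMod 4) P] (r : M →ₗ[ZMod 4] P) (s : P →ₗ[ZMod 4] M) (h : ∀ x, r (s x) = x) :
    M ≃ₗ[ZMod 4] P × LinearMap.ker r where
  toFun x := (r x, ⟨x - s (r x), by simp [h]⟩)
  map_add' x y := Prod.ext (by simp) (Subtype.ext (by simp; abel))
  map_smul' c x := Prod.ext (by simp) (Subtype.ext (by simp [smul_sub]))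
  invFun y := s y.1 + y.2
  left_inv x := by simp
  right_inv y := by
    have := y.2.2
    rw [LinearMap.mem_ker] at this
    exact Prod.ext (by simp [h, this]) (Subtype.ext (by simp [h, this]))

lemma finite_ker_of_split {M P : Type*} [AddCommGroup M] [Module (ZMod 4) M] [AddCommGroup P]
    [Module (ZMod 4) P] [Module.Finite (ZMod 4) M] (r : M →ₗ[ZMod 4] P) (s : P →ₗ[ZMod 4] M)
    (h : ∀ x, r (s x) = x) : Module.Finite (ZMod 4) (LinearMap.ker r) :=
  Module.Finite.of_surjective ((LinearMap.snd _ _ _).comp (splitEquiv r s h).toLinearMap)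
    (Prod.snd_surjective.comp (splitEquiv r s h).surjective)

lemma projective_ker_of_split {M P : Type*} [AddCommGroup M] [Module (ZMod 4) M] [AddCommGroup P]
    [Module (ZMod 4) P] [Module.Projective (ZMod 4) M] (r : M →ₗ[ZMod 4] P) (s : P →ₗ[ZMod 4] M)
    (h : ∀ x, r (s x) = x) : Module.Projective (ZMod 4) (LinearMap.ker r) :=
  Module.Projective.of_split
    ((splitEquiv r s h).symm.toLinearMap.comp (LinearMap.inr _ _ _))
    ((LinearMap.snd _ _ _).comp (splitEquiv r s h).toLinearMap) (LinearMap.ext fun x => by simp)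

section

variable {A B : Type} [AddCommGroup A] [Module (ZMod 4) A] [AddCommGroup B] [Module (ZMod 4) B]

/-- Every linear map has a generalized inverse modulo `2`. -/
lemma exists_generalized_inverse [Module.Projective (ZMod 4) B] (f : A →ₗ[ZMod 4] B) :
    ∃ g : B →ₗ[ZMod 4] A, ∀ a, f a - f (g (f a)) ∈ doubles B := by
  have hle : doubles B ≤ LinearMap.range f ⊔ doubles B := le_sup_right
  obtain ⟨ε, h1, h2⟩ := exists_approx_projection _ hle
  obtain ⟨g, hg⟩ := exists_linear_of_forall ε f (doubles B) (fun b => by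
    obtain ⟨_, ⟨a, rfl⟩, d, hd, h⟩ := Submodule.mem_sup.1 (h1 b)
    exact ⟨a, by rwa [← h, add_sub_cancel_left]⟩)
  refine ⟨g, fun a => ?_⟩
  have := (doubles B).add_mem (h2 (f a) (le_sup_left (a := LinearMap.range f) ⟨a, rfl⟩)) (hg (f a))
  simpa using this

variable [Module.Projective (ZMod 4) A] [Module.Projective (ZMod 4) B]
  [Module.Finite (ZMod 4) A]

/-- Every linear map is, modulo `2`, split on a direct summand. -/
lemma exists_unit_part (f : A →ₗ[ZMod 4] B) :
    ∃ (P : FGProj (ZMod 4)) (j : P.obj →ₗ[ZMod 4] A) (r : B →ₗ[ZMod 4] P.obj),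
      (∀ x, r (f (j x)) = x) ∧ ∀ a, f a - f (j (r (f a))) ∈ doubles B := by
  obtain ⟨g, hg⟩ := exists_generalized_inverse f
  let p : A →ₗ[ZMod 4] A := g.comp f
  -- `p` is idempotent only modulo 2. Its square is a true idempotent, because the error terms in
  -- the fourth power cancel modulo 4.
  have hp : ∀ a, ∃ c, p (p a) = p a + (2 : ZMod 4) • c := fun a => by
    obtain ⟨c, hc⟩ := mem_doubles.1 (hg a)
    refine ⟨g c, ?_⟩
    have := congrArg g hc
    rw [map_sub, map_smul] at this
    change g (f (g (f a))) = g (f a) + _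
    linear_combination (norm := module) -this - four_smul (g c)
  have hp4 : ∀ a, p (p (p (p a))) = p (p a) := fun a => by
    obtain ⟨c, hc⟩ := hp a
    obtain ⟨d, hd⟩ := hp c
    rw [hc, map_add, map_add, map_smul, map_smul, hc, hd, map_add, map_smul, hc]
    linear_combination (norm := module) four_smul (p c) + four_smul d
  let π : A →ₗ[ZMod 4] A := p.comp p
  have hπ : ∀ x : LinearMap.range π, π x = x := by
    rintro ⟨_, a, rfl⟩
    exact hp4 a
  have : Module.Finite (ZMod 4) (LinearMap.range π) := Module.Finite.range π
  have : Module.Projective (ZMod 4) (LinearMap.range π) :=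
    Module.Projective.of_split (LinearMap.range π).subtype π.rangeRestrict
      (LinearMap.ext fun x => Subtype.ext (hπ x))
  -- The factor `p.comp g` makes the composite of `f` and the retraction equal to the fourth power
  -- of `p`, which is `π`.
  refine ⟨FGProj.of (ZMod 4) (LinearMap.range π), (LinearMap.range π).subtype,
    π.rangeRestrict.comp (p.comp g), fun x => Subtype.ext ?_, fun a => ?_⟩
  · exact (congrArg π (hπ x)).trans (hπ x)
  · change f a - f (p (p (p (p a)))) ∈ _
    rw [hp4]
    have := (doubles B).add_mem (hg a) (hg (g (f a)))
    rwa [sub_add_sub_cancel] at this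

variable [Module.Finite (ZMod 4) B]

/-- Splitting off the part of a linear map that is nonzero modulo `2`. -/
lemma exists_splitting (f : A →ₗ[ZMod 4] B) :
    ∃ (P A₁ B₁ : FGProj (ZMod 4)) (a : A ≃ₗ[ZMod 4] P.obj × A₁.obj)
      (b : B ≃ₗ[ZMod 4] P.obj × B₁.obj) (t : A₁.obj →ₗ[ZMod 4] B₁.obj),
      ∀ x, b (f x) = ((a x).1, (2 : ZMod 4) • t (a x).2) := by
  obtain ⟨P, j, r, h1, h2⟩ := exists_unit_part f
  have hB : ∀ x, r ((f.comp j) x) = x := h1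
  have hA : ∀ x, (r.comp f) (j x) = x := h1
  have := finite_ker_of_split r _ hB
  have := finite_ker_of_split _ j hA
  have := projective_ker_of_split r _ hB
  have := projective_ker_of_split _ j hA
  obtain ⟨t, ht⟩ := exists_linear_of_forall (B := LinearMap.ker (r.comp f))
    (C := LinearMap.ker r) (f.restrict (p := LinearMap.ker (r.comp f)) (q := LinearMap.ker r)
      fun x hx => hx) (LinearMap.lsmul _ _ 2) ⊥ (by
    rintro ⟨x, hx⟩
    rw [LinearMap.mem_ker, LinearMap.comp_apply] at hx
    obtain ⟨y, hy⟩ := mem_doubles.1 (h2 x)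
    rw [hx, map_zero, map_zero, sub_zero] at hy
    -- `y` is a half of `f x`, but it need not lie in the kernel of `r`. Subtracting `f (j (r y))`
    -- puts it there and leaves the double unchanged.
    refine ⟨⟨y - f (j (r y)), by simp [h1]⟩, ?_⟩
    rw [Submodule.mem_bot, sub_eq_zero]
    apply Subtype.ext
    have h3 : (2 : ZMod 4) • f (j (r y)) = 0 := by
      rw [← map_smul, ← map_smul, ← map_smul, ← hy, hx, map_zero, map_zero]
    change f x = (2 : ZMod 4) • (y - f (j (r y)))
    rw [smul_sub, h3, hy, sub_zero])
  refine ⟨P, FGProj.of (ZMod 4) (LinearMap.ker (r.comp f)), FGProj.of (ZMod 4) (LinearMap.ker r),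
    splitEquiv _ j hA, splitEquiv r _ hB, t, fun x => Prod.ext rfl ?_⟩
  have h3 := (Submodule.mem_bot _).1 (ht (splitEquiv _ j hA x).2)
  rw [sub_eq_zero] at h3
  refine Eq.trans (Subtype.ext ?_) h3
  change f x - f (j (r (f x))) = f (x - j (r (f x)))
  rw [map_sub]

/-- Every linear map between finitely generated projective modules is the direct sum of an
isomorphism, a zero map and a multiplication by `2`. -/
lemma exists_normal_form (f : A →ₗ[ZMod 4] B) :
    ∃ (P S S' Q : FGProj (ZMod 4)) (a : A ≃ₗ[ZMod 4] (P.obj × S.obj) × Q.obj)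
      (b : B ≃ₗ[ZMod 4] (P.obj × S'.obj) × Q.obj),
      ∀ x, b (f x) = (((a x).1.1, 0), (2 : ZMod 4) • (a x).2) := by
  obtain ⟨P, A₁, B₁, a, b, t, h⟩ := exists_splitting f
  -- Splitting `t` as well leaves `2 • 2 • t'`, which is zero.
  obtain ⟨Q, S, S', a', b', t', h'⟩ := exists_splitting t
  refine ⟨P, S, S', Q,
    a.trans ((LinearEquiv.prodCongr (LinearEquiv.refl _ _)
      (a'.trans (LinearEquiv.prodComm _ _ _))).trans (LinearEquiv.prodAssoc _ _ _ _).symm),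
    b.trans ((LinearEquiv.prodCongr (LinearEquiv.refl _ _)
      (b'.trans (LinearEquiv.prodComm _ _ _))).trans (LinearEquiv.prodAssoc _ _ _ _).symm),
    fun x => ?_⟩
  have h1 : b' (b (f x)).2 = ((2 : ZMod 4) • (a' (a x).2).1, 0) := by
    rw [h, map_smul, h', Prod.smul_mk, two_smul_two_smul]
  have h2 : (b (f x)).1 = (a x).1 := congrArg Prod.fst (h x)
  have h3 : (b' (b (f x)).2).1 = (2 : ZMod 4) • (a' (a x).2).1 := congrArg Prod.fst h1
  have h4 : (b' (b (f x)).2).2 = 0 := congrArg Prod.snd h1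
  exact Prod.ext (Prod.ext h2 h4) h3

end

end

/-! ### Good triangles from contractions and multiplications by 2 -/

section

variable {A B C A' B' C' : Type*}
  [AddCommGroup A'] [Module (ZMod 4) A'] [AddCommGroup B'] [Module (ZMod 4) B']
  [AddCommGroup C'] [Module (ZMod 4) C'] [AddCommGroup A] [Module (ZMod 4) A]
  [AddCommGroup B] [Module (ZMod 4) B] [AddCommGroup C] [Module (ZMod 4) C]

lemma exact_prodMap {f : A →ₗ[ZMod 4] B} {i : B →ₗ[ZMod 4] C} {f' : A' →ₗ[ZMod 4] B'}
    {i' : B' →ₗ[ZMod 4] C'} (h : Function.Exact f i) (h' : Function.Exact f' i') :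
    Function.Exact (f.prodMap f') (i.prodMap i') := by
  rintro ⟨x, y⟩
  simp [h x, h' y]

lemma IsGood.prodMap {f : A →ₗ[ZMod 4] B} {i : B →ₗ[ZMod 4] C} {q : C →ₗ[ZMod 4] A}
    {f' : A' →ₗ[ZMod 4] B'} {i' : B' →ₗ[ZMod 4] C'} {q' : C' →ₗ[ZMod 4] A'}
    (h : IsGood f i q) (h' : IsGood f' i' q') :
    IsGood (f.prodMap f') (i.prodMap i') (q.prodMap q') where
  exact₁ := exact_prodMap h.exact₁ h'.exact₁
  exact₂ := exact_prodMap h.exact₂ h'.exact₂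
  exact₃ := exact_prodMap h.exact₃ h'.exact₃
  extend x y hxy := by
    obtain ⟨z, hz⟩ := h.extend x.1 y.1 (congrArg Prod.fst hxy)
    obtain ⟨z', hz'⟩ := h'.extend x.2 y.2 (congrArg Prod.snd hxy)
    exact ⟨(z, z'), Prod.ext hz.1 hz'.1, Prod.ext hz.2 hz'.2⟩

lemma isGood_two [Module.Projective (ZMod 4) A] :
    IsGood (LinearMap.lsmul (ZMod 4) A 2) (LinearMap.lsmul (ZMod 4) A 2)
      (LinearMap.lsmul (ZMod 4) A 2) := by
  have h : Function.Exact (LinearMap.lsmul (ZMod 4) A 2) (LinearMap.lsmul (ZMod 4) A 2) := by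
    intro y
    constructor
    · intro hy
      obtain ⟨b, hb⟩ := exists_eq_two_smul hy
      exact ⟨b, hb.symm⟩
    · rintro ⟨x, rfl⟩
      exact two_smul_two_smul x
  exact ⟨⟨h, h, h⟩, fun x y hxy => ⟨x, hxy.symm, rfl⟩⟩

/-- A candidate triangle with a contraction is good. -/
lemma IsGood.of_contraction [Module.Projective (ZMod 4) C] {f : A →ₗ[ZMod 4] B}
    {i : B →ₗ[ZMod 4] C} {q : C →ₗ[ZMod 4] A}
    (h₁ : ∀ a, i (f a) = 0) (h₂ : ∀ b, q (i b) = 0) (h₃ : ∀ c, f (q c) = 0)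
    (α₁ : B →ₗ[ZMod 4] A) (α₂ : C →ₗ[ZMod 4] B) (α₀ : A →ₗ[ZMod 4] C)
    (hB : ∀ b, -b = f (α₁ b) + α₂ (i b)) (hC : ∀ c, -c = i (α₂ c) + α₀ (q c))
    (hA : ∀ a, -a = q (α₀ a) + α₁ (f a)) : IsGood f i q where
  exact₁ b := ⟨fun hb => ⟨-α₁ b, by
    have := hB b
    rw [hb, map_zero, add_zero] at this
    rw [map_neg, ← this, neg_neg]⟩, by rintro ⟨a, rfl⟩; exact h₁ a⟩
  exact₂ c := ⟨fun hc => ⟨-α₂ c, by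
    have := hC c
    rw [hc, map_zero, add_zero] at this
    rw [map_neg, ← this, neg_neg]⟩, by rintro ⟨b, rfl⟩; exact h₂ b⟩
  exact₃ a := ⟨fun ha => ⟨-α₀ a, by
    have := hA a
    rw [ha, map_zero, add_zero] at this
    rw [map_neg, ← this, neg_neg]⟩, by rintro ⟨c, rfl⟩; exact h₃ c⟩
  extend x y hxy := by
    obtain ⟨z, hz⟩ := exists_eq_two_smul (c := i y) (by rw [← map_smul, ← hxy, h₁])
    -- The first term is sent to `2 x` by `q`, since `f (2 x) = 4 y = 0`, and its double vanishes.
    -- The second is a half of `i y`, by the homotopy at `C` evaluated on `i y = 2 z`, and `q` kills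
    -- it.
    refine ⟨-(2 : ZMod 4) • α₀ x - i (α₂ z), ?_, ?_⟩
    · have h4 := hC ((2 : ZMod 4) • z)
      rw [← hz, h₂, map_zero, add_zero, hz, map_smul, map_smul] at h4
      rw [hz]
      linear_combination (norm := module) -h4 + four_smul (α₀ x)
    · have h4 := hA ((2 : ZMod 4) • x)
      rw [map_smul f, hxy, two_smul_two_smul, map_zero, add_zero, map_smul, map_smul] at h4
      rw [map_sub, h₂, map_smul]
      linear_combination (norm := module) h4

section Contractible

variable (P S S' : Type*) [AddCommGroup S'] [Module (ZMod 4) S'] [AddCommGroup S]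
  [Module (ZMod 4) S] [AddCommGroup P] [Module (ZMod 4) P]

/-- The first map of the sum of the contractible triangles on `P`, `S` and `S'`. -/
def contr₁ : P × S →ₗ[ZMod 4] P × S' := (LinearMap.inl _ _ _).comp (LinearMap.fst _ _ _)

/-- The second map of the sum of the contractible triangles on `P`, `S` and `S'`. -/
def contr₂ : P × S' →ₗ[ZMod 4] S' × S := (LinearMap.inl _ _ _).comp (LinearMap.snd _ _ _)

/-- The third map of the sum of the contractible triangles on `P`, `S` and `S'`. -/
def contr₃ : S' × S →ₗ[ZMod 4] P × S := (LinearMap.inr _ _ _).comp (LinearMap.snd _ _ _)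

/-- The second component of a contraction. -/
def contrHomotopy₂ : S' × S →ₗ[ZMod 4] P × S' := -(LinearMap.inr _ _ _).comp (LinearMap.fst _ _ _)

/-- The third component of a contraction. -/
def contrHomotopy₀ : P × S →ₗ[ZMod 4] S' × S := -(LinearMap.inr _ _ _).comp (LinearMap.snd _ _ _)

lemma contr_contraction :
    (∀ b, -b = contr₁ P S S' ((-contr₁ P S' S) b) + contrHomotopy₂ P S S' (contr₂ P S S' b)) ∧
    (∀ c, -c = contr₂ P S S' (contrHomotopy₂ P S S' c) + contrHomotopy₀ P S S' (contr₃ P S S' c)) ∧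
    ∀ a, -a = contr₃ P S S' (contrHomotopy₀ P S S' a) + (-contr₁ P S' S) (contr₁ P S S' a) := by
  refine ⟨?_, ?_, ?_⟩ <;> rintro ⟨x, y⟩ <;>
    simp [contr₁, contr₂, contr₃, contrHomotopy₂, contrHomotopy₀]

lemma isGood_contr [Module.Projective (ZMod 4) S] [Module.Projective (ZMod 4) S'] :
    IsGood (contr₁ P S S') (contr₂ P S S') (contr₃ P S S') :=
  IsGood.of_contraction (by simp [contr₁, contr₂]) (by simp [contr₂, contr₃])
    (by simp [contr₁, contr₃]) (-contr₁ P S' S) (contrHomotopy₂ P S S') (contrHomotopy₀ P S S')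
    (contr_contraction P S S').1 (contr_contraction P S S').2.1 (contr_contraction P S S').2.2

/-- On `S'` the map must be `i ∘ b`. On `S` it must lift `a` through `q`, which is possible by
exactness because `contr₁` vanishes on `S`, so `f ∘ a` does too. -/
lemma exists_fill_contr [Module.Projective (ZMod 4) S] {f : A →ₗ[ZMod 4] B}
    {i : B →ₗ[ZMod 4] C} {q : C →ₗ[ZMod 4] A} (h : IsQuasiExact f i q)
    (a : P × S →ₗ[ZMod 4] A) (b : P × S' →ₗ[ZMod 4] B) (hab : ∀ x, b (contr₁ P S S' x) = f (a x)) :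
    ∃ c : S' × S →ₗ[ZMod 4] C, (∀ y, c (contr₂ P S S' y) = i (b y)) ∧
      ∀ z, q (c z) = a (contr₃ P S S' z) := by
  obtain ⟨m, hm⟩ := exists_linear_of_forall (a.comp (LinearMap.inr _ _ _)) q ⊥ (fun s => by
    obtain ⟨c, hc⟩ := (h.exact₃ (a (0, s))).1 (by
      rw [← hab]
      simp [contr₁, ← Prod.zero_eq_mk])
    exact ⟨c, by simp [hc]⟩)
  have hm' : ∀ s, a (0, s) = q (m s) := fun s => sub_eq_zero.1 ((Submodule.mem_bot _).1 (hm s))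
  refine ⟨(i.comp (b.comp (LinearMap.inr _ _ _))).coprod m, ?_, ?_⟩
  · rintro ⟨p, s'⟩
    have h1 : i (b (p, 0)) = 0 := by
      have := hab (p, 0)
      simp only [contr₁, LinearMap.comp_apply, LinearMap.fst_apply, LinearMap.inl_apply] at this
      rw [this, h.exact₁.apply_apply_eq_zero]
    have h2 : ((p, s') : P × S') = (p, 0) + (0, s') := by simp
    rw [h2, map_add, map_add, map_add, map_add, h1]
    simp [contr₂, ← Prod.zero_eq_mk]
  · rintro ⟨s', s⟩
    simp [contr₃, h.exact₂.apply_apply_eq_zero, hm']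

end Contractible

/-- The extension property supplies a value for each element of `Q`; projectivity makes the choice
linear. Testing on `ZMod 4` is therefore enough for every projective `Q`. -/
lemma exists_fill_two {Q : Type*} [AddCommGroup Q] [Module (ZMod 4) Q]
    [Module.Projective (ZMod 4) Q] {f : A →ₗ[ZMod 4] B}
    {i : B →ₗ[ZMod 4] C} {q : C →ₗ[ZMod 4] A} (h : IsGood f i q)
    (a : Q →ₗ[ZMod 4] A) (b : Q →ₗ[ZMod 4] B) (hab : ∀ x, b ((2 : ZMod 4) • x) = f (a x)) :
    ∃ c : Q →ₗ[ZMod 4] C, (∀ y, c ((2 : ZMod 4) • y) = i (b y)) ∧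
      ∀ z, q (c z) = a ((2 : ZMod 4) • z) := by
  obtain ⟨m, hm⟩ := exists_linear_of_forall ((i.comp b).prod ((2 : ZMod 4) • a))
    ((LinearMap.lsmul (ZMod 4) C 2).prod q) ⊥ (fun s => by
    obtain ⟨c, hc, hc'⟩ := h.extend (a s) (b s) (by rw [← hab, map_smul])
    exact ⟨c, by simp [hc, hc']⟩)
  have hm' := fun s => sub_eq_zero.1 ((Submodule.mem_bot _).1 (hm s))
  exact ⟨m, fun y => (map_smul m _ _).trans (congrArg Prod.fst (hm' y)).symm,
    fun y => (congrArg Prod.snd (hm' y)).symm.trans (map_smul a _ _).symm⟩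

end

section

variable (P S S' Q : FGProj (ZMod 4))

/-- The first map of the sum of a contractible triangle and a triangle of multiplications by 2. -/
abbrev normal₁ : (P.obj × S.obj) × Q.obj →ₗ[ZMod 4] (P.obj × S'.obj) × Q.obj :=
  (contr₁ P.obj S.obj S'.obj).prodMap (LinearMap.lsmul (ZMod 4) Q.obj 2)

/-- The second map of the sum of a contractible triangle and a triangle of multiplications by 2. -/
abbrev normal₂ : (P.obj × S'.obj) × Q.obj →ₗ[ZMod 4] (S'.obj × S.obj) × Q.obj :=
  (contr₂ P.obj S.obj S'.obj).prodMap (LinearMap.lsmul (ZMod 4) Q.obj 2)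

/-- The third map of the sum of a contractible triangle and a triangle of multiplications by 2. -/
abbrev normal₃ : (S'.obj × S.obj) × Q.obj →ₗ[ZMod 4] (P.obj × S.obj) × Q.obj :=
  (contr₃ P.obj S.obj S'.obj).prodMap (LinearMap.lsmul (ZMod 4) Q.obj 2)

lemma isGood_normal : IsGood (normal₁ P S S' Q) (normal₂ P S S' Q) (normal₃ P S S' Q) :=
  (isGood_contr _ _ _).prodMap isGood_two

lemma exists_fill_normal {A B C : Type*} [AddCommGroup A] [Module (ZMod 4) A] [AddCommGroup B]
    [Module (ZMod 4) B] [AddCommGroup C] [Module (ZMod 4) C] {f : A →ₗ[ZMod 4] B}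
    {i : B →ₗ[ZMod 4] C} {q : C →ₗ[ZMod 4] A} (h : IsGood f i q)
    (a : (P.obj × S.obj) × Q.obj →ₗ[ZMod 4] A) (b : (P.obj × S'.obj) × Q.obj →ₗ[ZMod 4] B)
    (hab : ∀ x, b (normal₁ P S S' Q x) = f (a x)) :
    ∃ c : (S'.obj × S.obj) × Q.obj →ₗ[ZMod 4] C, (∀ y, c (normal₂ P S S' Q y) = i (b y)) ∧
      ∀ z, q (c z) = a (normal₃ P S S' Q z) := by
  obtain ⟨c₁, h1, h2⟩ := exists_fill_contr P.obj S.obj S'.obj h.toIsQuasiExact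
    (a.comp (LinearMap.inl _ _ _)) (b.comp (LinearMap.inl _ _ _)) (fun x => by
      simpa using hab (x, 0))
  obtain ⟨c₂, h3, h4⟩ := exists_fill_two h
    (a.comp (LinearMap.inr _ _ _)) (b.comp (LinearMap.inr _ _ _)) (fun x => by
      have : normal₁ P S S' Q (0, x) = (0, (2 : ZMod 4) • x) := by simp
      simpa only [LinearMap.comp_apply, LinearMap.inr_apply, this] using hab (0, x))
  refine ⟨c₁.coprod c₂, ?_, ?_⟩
  · rintro ⟨y, w⟩
    have : ((y, w) : (P.obj × S'.obj) × Q.obj) = (y, 0) + (0, w) := by simp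
    rw [this, map_add b, map_add i]
    simpa using congrArg₂ (· + ·) (h1 y) (h3 w)
  · rintro ⟨y, w⟩
    have : normal₃ P S S' Q (y, w) =
      (contr₃ P.obj S.obj S'.obj y, 0) + (0, (2 : ZMod 4) • w) := by simp
    rw [this, map_add a]
    rw [LinearMap.coprod_apply, map_add]
    exact congrArg₂ (· + ·) (h2 y) (h4 w)

end

/-! ### Structure of good triangles and completion of morphisms -/

section

variable {A B C : Type} [AddCommGroup A] [Module (ZMod 4) A] [AddCommGroup B] [Module (ZMod 4) B]
  [AddCommGroup C] [Module (ZMod 4) C] [Module.Projective (ZMod 4) A]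
  [Module.Projective (ZMod 4) B] [Module.Finite (ZMod 4) A] [Module.Finite (ZMod 4) B]
  {f : A →ₗ[ZMod 4] B} {i : B →ₗ[ZMod 4] C} {q : C →ₗ[ZMod 4] A}

/-- A good triangle is the sum of a contractible triangle and a triangle of multiplications
by `2`. -/
lemma IsGood.exists_equiv_normal (h : IsGood f i q) :
    ∃ (P S S' Q : FGProj (ZMod 4)) (a : ((P.obj × S.obj) × Q.obj) ≃ₗ[ZMod 4] A)
      (b : ((P.obj × S'.obj) × Q.obj) ≃ₗ[ZMod 4] B) (c : ((S'.obj × S.obj) × Q.obj) ≃ₗ[ZMod 4] C),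
      (∀ x, b (normal₁ P S S' Q x) = f (a x)) ∧ (∀ y, c (normal₂ P S S' Q y) = i (b y)) ∧
      ∀ z, q (c z) = a (normal₃ P S S' Q z) := by
  obtain ⟨P, S, S', Q, a, b, hab⟩ := exists_normal_form f
  have hab' : ∀ x, b.symm (normal₁ P S S' Q x) = f (a.symm x) := fun x => by
    rw [LinearEquiv.symm_apply_eq, hab]
    simp [contr₁]
  obtain ⟨c, h1, h2⟩ := exists_fill_normal P S S' Q h a.symm.toLinearMap b.symm.toLinearMap hab'
  have hc : Function.Bijective c := (isGood_normal P S S' Q).bijective h.toIsQuasiExact hab' h1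
    (fun z => (h2 z).symm) a.symm.bijective b.symm.bijective
  exact ⟨P, S, S', Q, a.symm, b.symm, LinearEquiv.ofBijective c hc, hab', h1, h2⟩

/-- Morphisms of good triangles can be completed. -/
lemma IsGood.exists_fill {A' B' C' : Type*} [AddCommGroup A'] [Module (ZMod 4) A']
    [AddCommGroup B'] [Module (ZMod 4) B'] [AddCommGroup C'] [Module (ZMod 4) C']
    {f' : A' →ₗ[ZMod 4] B'} {i' : B' →ₗ[ZMod 4] C'} {q' : C' →ₗ[ZMod 4] A'}
    (h : IsGood f i q) (h' : IsGood f' i' q') (a : A →ₗ[ZMod 4] A') (b : B →ₗ[ZMod 4] B')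
    (hab : ∀ x, b (f x) = f' (a x)) :
    ∃ c : C →ₗ[ZMod 4] C', (∀ y, c (i y) = i' (b y)) ∧ ∀ z, q' (c z) = a (q z) := by
  obtain ⟨P, S, S', Q, a₀, b₀, c₀, h1, h2, h3⟩ := h.exists_equiv_normal
  obtain ⟨c, h4, h5⟩ := exists_fill_normal P S S' Q h' (a.comp a₀.toLinearMap)
    (b.comp b₀.toLinearMap) (fun x => (congrArg b (h1 x)).trans (hab _))
  refine ⟨c.comp c₀.symm.toLinearMap, fun y => ?_, fun z => ?_⟩
  · obtain ⟨y, rfl⟩ := b₀.surjective y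
    rw [← h2]
    simpa using h4 y
  · obtain ⟨z, rfl⟩ := c₀.surjective z
    rw [h3]
    simpa using h5 z

/-- Every linear map is the first map of a good triangle. -/
lemma exists_isGood (f : A →ₗ[ZMod 4] B) :
    ∃ (Z : FGProj (ZMod 4)) (i : B →ₗ[ZMod 4] Z.obj) (q : Z.obj →ₗ[ZMod 4] A), IsGood f i q := by
  obtain ⟨P, S, S', Q, a, b, hab⟩ := exists_normal_form f
  refine ⟨FGProj.of (ZMod 4) ((S'.obj × S.obj) × Q.obj),
    (normal₂ P S S' Q).comp b.toLinearMap, a.symm.toLinearMap.comp (normal₃ P S S' Q),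
    (isGood_normal P S S' Q).of_equiv a.symm b.symm (LinearEquiv.refl _ _) (fun x => ?_)
      (fun y => ?_) (fun z => rfl)⟩
  · rw [LinearEquiv.symm_apply_eq, hab]
    simp [contr₁]
  · exact congrArg (normal₂ P S S' Q) (b.apply_symm_apply y).symm

end

/-! ### Mayer-Vietoris triangles and the octahedron -/

section

variable {A B C B' C' : Type} [AddCommGroup A] [Module (ZMod 4) A] [AddCommGroup B]
  [Module (ZMod 4) B] [AddCommGroup C] [Module (ZMod 4) C]
  [AddCommGroup B'] [Module (ZMod 4) B'] [AddCommGroup C'] [Module (ZMod 4) C']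
  {v : B →ₗ[ZMod 4] B'} {i' : B' →ₗ[ZMod 4] C'} {q' : C' →ₗ[ZMod 4] A}
  {f : A →ₗ[ZMod 4] B} {i : B →ₗ[ZMod 4] C} {q : C →ₗ[ZMod 4] A}

/-- The Mayer-Vietoris sequence of a morphism of quasi-exact triangles that is the identity on
the first objects. -/
lemma isQuasiExact_mayerVietoris (h : IsQuasiExact f i q) (h' : IsQuasiExact (v.comp f) i' q')
    {m : C →ₗ[ZMod 4] C'} (hm : ∀ y, m (i y) = i' (v y)) (hm' : ∀ z, q' (m z) = q z) :
    IsQuasiExact (v.prod i) (i'.coprod (-m)) (f.comp q') where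
  exact₁ := by
    rintro ⟨y', z⟩
    constructor
    · intro e
      have e1 : i' y' = m z := by simpa [← sub_eq_add_neg, sub_eq_zero] using e
      obtain ⟨y, hy⟩ := (h.exact₂ z).1 (by rw [← hm', ← e1, h'.exact₂.apply_apply_eq_zero])
      obtain ⟨a, ha⟩ := (h'.exact₁ (y' - v y)).1 (by rw [map_sub, e1, ← hy, hm, sub_self])
      rw [LinearMap.comp_apply] at ha
      refine ⟨y + f a, Prod.ext ?_ ?_⟩
      · simp [ha]
      · simp [hy, h.exact₁.apply_apply_eq_zero]
    · rintro ⟨y, e⟩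
      obtain ⟨rfl, rfl⟩ := Prod.mk.inj e
      simp [hm]
  exact₂ := by
    intro w
    constructor
    · intro e
      obtain ⟨z, hz⟩ := (h.exact₃ (q' w)).1 e
      obtain ⟨y', hy'⟩ := (h'.exact₂ (w - m z)).1 (by rw [map_sub, hm', hz, sub_self])
      exact ⟨(y', -z), by simp [hy']⟩
    · rintro ⟨⟨y', z⟩, rfl⟩
      simp [hm', h'.exact₂.apply_apply_eq_zero, h.exact₃.apply_apply_eq_zero]
  exact₃ := by
    intro y
    constructor
    · intro e
      obtain ⟨e1, e2⟩ := Prod.mk.inj e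
      obtain ⟨a, rfl⟩ := (h.exact₁ y).1 e2
      obtain ⟨w, rfl⟩ := (h'.exact₃ a).1 e1
      exact ⟨w, rfl⟩
    · rintro ⟨w, rfl⟩
      exact Prod.ext (h'.exact₃.apply_apply_eq_zero w) (h.exact₁.apply_apply_eq_zero _)

/-- The triples that are congruent modulo `2` to the boundary of a partial morphism. -/
def obstructed (v : B →ₗ[ZMod 4] B') (i : B →ₗ[ZMod 4] C) : Submodule (ZMod 4) C where
  -- These are the `z` for which `y` and `(y', z)` form a partial morphism from the triangle of 2s
  -- to the Mayer-Vietoris triangle.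
  carrier := {z | ∃ y y', v y = (2 : ZMod 4) • y' ∧ i y = (2 : ZMod 4) • z}
  zero_mem' := ⟨0, 0, by simp, by simp⟩
  add_mem' := by
    rintro z₁ z₂ ⟨y₁, y₁', h1, h2⟩ ⟨y₂, y₂', h3, h4⟩
    exact ⟨y₁ + y₂, y₁' + y₂', by rw [map_add, h1, h3, smul_add], by rw [map_add, h2, h4, smul_add]⟩
  smul_mem' := by
    rintro c z ⟨y, y', h1, h2⟩
    exact ⟨c • y, c • y', by rw [map_smul, h1, smul_comm], by rw [map_smul, h2, smul_comm]⟩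

/-- The corrections of the morphism `m` that allow a partial morphism to be extended. -/
def corrections (f : A →ₗ[ZMod 4] B) (v : B →ₗ[ZMod 4] B') (i : B →ₗ[ZMod 4] C)
    (i' : B' →ₗ[ZMod 4] C') (q' : C' →ₗ[ZMod 4] A) (m : C →ₗ[ZMod 4] C') :
    Submodule (ZMod 4) (C × C') where
  -- With `zw = (z, w)`, changing `m z` to `m z - 2 w` turns the defect `2 z₁` into `2 (z₁ + w)`,
  -- and the fourth condition says that `z₁ + w` then extends the partial morphism. The last
  -- condition makes `q'` kill the change `2 w`.
  carrier := {zw | ∃ y y' z₁ x, v y = (2 : ZMod 4) • y' ∧ i y = (2 : ZMod 4) • zw.1 ∧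
    i' y' - m zw.1 = (2 : ZMod 4) • z₁ ∧ f (q' (z₁ + zw.2)) = (2 : ZMod 4) • y ∧
    q' zw.2 = (2 : ZMod 4) • x}
  zero_mem' := ⟨0, 0, 0, 0, by simp⟩
  add_mem' := by
    rintro ⟨z, w⟩ ⟨z', w'⟩ ⟨y, y', z₁, x, h1, h2, h3, h4, h5⟩ ⟨t, t', s₁, r, k1, k2, k3, k4, k5⟩
    simp only at h1 h2 h3 h4 h5 k1 k2 k3 k4 k5
    refine ⟨y + t, y' + t', z₁ + s₁, x + r, ?_, ?_, ?_, ?_, ?_⟩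
    · rw [map_add, h1, k1, smul_add]
    · simp [h2, k2]
    · simp only [Prod.mk_add_mk, map_add, smul_add, ← h3, ← k3]
      abel
    · simp only [Prod.mk_add_mk, smul_add, ← h4, ← k4, map_add]
      abel
    · simp [h5, k5]
  smul_mem' := by
    rintro c ⟨z, w⟩ ⟨y, y', z₁, x, h1, h2, h3, h4, h5⟩
    simp only at h1 h2 h3 h4 h5
    refine ⟨c • y, c • y', c • z₁, c • x, ?_, ?_, ?_, ?_, ?_⟩
    · rw [map_smul, h1, smul_comm]
    · rw [Prod.smul_mk, map_smul, h2, smul_comm]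
    · rw [Prod.smul_mk, map_smul, map_smul, ← smul_sub, h3, smul_comm]
    · rw [Prod.smul_mk, ← smul_add, map_smul, map_smul, h4, smul_comm]
    · rw [Prod.smul_mk, map_smul, h5, smul_comm]

variable [Module.Projective (ZMod 4) A] [Module.Projective (ZMod 4) B]
  [Module.Projective (ZMod 4) B'] [Module.Projective (ZMod 4) C']

/-- Rotating the first triangle gives `x` with `q z = 2 x` and `-f x = 2 y`. Then `q' z₁ + x` is
killed by 2, hence equals `2 x₁`, and the second triangle provides `w` with `q' w = 2 x₁`. The terms
`2 f x₁` from `z₁` and from `w` cancel, leaving `-f x = 2 y`. -/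
lemma exists_correction (h : IsGood f i q) (h' : IsGood (v.comp f) i' q')
    {m : C →ₗ[ZMod 4] C'} (hm : ∀ y, m (i y) = i' (v y)) (hm' : ∀ z, q' (m z) = q z)
    {z : C} (hz : z ∈ obstructed v i) : ∃ w, (z, w) ∈ corrections f v i i' q' m := by
  obtain ⟨y, y', h1, h2⟩ := hz
  obtain ⟨x, h3, h4⟩ := h.rotate.extend y z h2
  rw [LinearMap.neg_apply] at h4
  obtain ⟨z₁, hz₁⟩ := exists_eq_two_smul (c := i' y' - m z) (by
    rw [smul_sub, ← map_smul, ← map_smul, ← h1, ← h2, hm, sub_self])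
  obtain ⟨x₁, hx₁⟩ := exists_eq_two_smul (c := q' z₁ + x) (by
    have := congrArg q' hz₁
    rw [map_sub, h'.exact₂.apply_apply_eq_zero, hm', h3, map_smul] at this
    linear_combination (norm := module) -this)
  obtain ⟨η, hη⟩ := exists_eq_two_smul (c := v (f x₁)) (by
    have := congrArg (v.comp f) hx₁
    rw [map_add, h'.exact₃.apply_apply_eq_zero, zero_add, LinearMap.comp_apply] at this
    rw [← map_smul, ← map_smul, ← LinearMap.comp_apply, ← this, ← neg_neg (f x), h4, map_neg,
      map_smul, h1, two_smul_two_smul, neg_zero])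
  obtain ⟨w, -, hw⟩ := h'.extend x₁ η hη
  refine ⟨w, y, y', z₁, x₁, h1, h2, hz₁, ?_, hw⟩
  have := congrArg f hx₁
  rw [map_add, map_smul] at this
  rw [map_add, map_add, hw, map_smul]
  linear_combination (norm := module) this + h4 + four_smul (f x₁)

variable [Module.Projective (ZMod 4) C] [Module.Finite (ZMod 4) A]
  [Module.Finite (ZMod 4) B]

/-- A morphism of good triangles that is the identity on the first objects can be chosen so that
the resulting Mayer-Vietoris triangle is good. -/
lemma exists_isGood_mayerVietoris (h : IsGood f i q) (h' : IsGood (v.comp f) i' q') :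
    ∃ m : C →ₗ[ZMod 4] C', (∀ y, m (i y) = i' (v y)) ∧ (∀ z, q' (m z) = q z) ∧
      IsGood (v.prod i) (i'.coprod (-m)) (f.comp q') := by
  obtain ⟨m, hm, hm'⟩ := h.exists_fill h' LinearMap.id v (fun x => rfl)
  change ∀ z, q' (m z) = q z at hm'
  -- Doubles and the image of `i` need no correction. `ε` projects, modulo 2, the obstructed
  -- elements onto a complement of these.
  have hD1 : doubles C ≤ doubles C ⊔ LinearMap.range i := le_sup_left
  have hD2 : doubles C ⊔ LinearMap.range i ≤ obstructed v i := by
    refine sup_le ?_ ?_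
    · intro z hz
      obtain ⟨c, rfl⟩ := mem_doubles.1 hz
      exact ⟨0, 0, by simp, by simp [two_smul_two_smul]⟩
    · rintro _ ⟨b, rfl⟩
      exact ⟨(2 : ZMod 4) • b, v b, map_smul _ _ _, map_smul _ _ _⟩
  obtain ⟨ε, hε1, hε2, hε3⟩ := exists_approx_projection_of_le _ _ hD1 hD2
  obtain ⟨l, hl⟩ := exists_linear_selection
    ((corrections f v i i' q' m).comap (ε.prodMap LinearMap.id)) (fun c =>
      exists_correction h h' hm hm' (hε1 c))
  have hl' : ∀ c, (ε (ε c), l (ε c)) ∈ corrections f v i i' q' m := fun c => hl (ε c)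
  -- The second use of `ε` makes `μ` vanish on the image of `i`: there `ε` is even, and `μ` doubles
  -- once more.
  let μ : C →ₗ[ZMod 4] C' := (2 : ZMod 4) • l.comp ε
  have hμi : ∀ y, μ (i y) = 0 := fun y => by
    obtain ⟨c, hc⟩ := mem_doubles.1 (hε2 (i y) (le_sup_right (a := doubles C) ⟨y, rfl⟩))
    change (2 : ZMod 4) • l (ε (i y)) = 0
    rw [hc, map_smul, two_smul_two_smul]
  have hμq : ∀ z, q' (μ z) = 0 := fun z => by
    obtain ⟨-, -, -, x, -, -, -, -, hx⟩ := hl' z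
    change q' ((2 : ZMod 4) • l (ε z)) = 0
    simp only at hx
    rw [map_smul, hx, two_smul_two_smul]
  have hn : ∀ y, (m - μ) (i y) = i' (v y) := fun y => by
    rw [LinearMap.sub_apply, hμi, sub_zero, hm]
  have hn' : ∀ z, q' ((m - μ) z) = q z := fun z => by
    rw [LinearMap.sub_apply, map_sub, hμq, sub_zero, hm']
  refine ⟨m - μ, hn, hn', isQuasiExact_mayerVietoris h.toIsQuasiExact h'.toIsQuasiExact hn hn', ?_⟩
  rintro y ⟨y', z⟩ hyz
  obtain ⟨h1, h2⟩ : v y = (2 : ZMod 4) • y' ∧ i y = (2 : ZMod 4) • z := Prod.mk.inj hyz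
  have hz : z ∈ obstructed v i := ⟨y, y', h1, h2⟩
  have hz' : z - ε (ε z) ∈ doubles C ⊔ LinearMap.range i := by
    have := Submodule.add_mem _ (hε3 z hz) (hε3 (ε z) (hε1 z))
    rwa [sub_add_sub_cancel] at this
  obtain ⟨_, hc, _, ⟨b, rfl⟩, hcb⟩ := Submodule.mem_sup.1 hz'
  obtain ⟨c, rfl⟩ := mem_doubles.1 hc
  obtain ⟨y₀, y₀', z₁, x, k1, k2, k3, k4, k5⟩ := hl' z
  simp only at k1 k2 k3 k4 k5
  -- The given partial morphism differs from the selected one at `ε (ε z)` by the trivial part from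
  -- `b` and `c` and by one that comes from the second good triangle, which extends by `h'`.
  obtain ⟨a, ha⟩ := (h.exact₁ (y - y₀ - (2 : ZMod 4) • b)).1 (by
    rw [map_sub, map_sub, map_smul, h2, k2]
    linear_combination (norm := module) -(2 : ZMod 4) • hcb + four_smul c)
  obtain ⟨w, hw, hw'⟩ := h'.extend a (y' - y₀' - v b) (by
    rw [LinearMap.comp_apply, ha, map_sub, map_sub, map_smul, h1, k1]
    module)
  have hza : z = ε (ε z) + i b + (2 : ZMod 4) • c := by
    linear_combination (norm := module) -hcb
  have hmz : m z = m (ε (ε z)) + i' (v b) + (2 : ZMod 4) • m c := by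
    rw [← hm, ← map_smul, ← map_add, ← map_add, ← hza]
  refine ⟨z₁ + l (ε z) + w - m c, ?_, ?_⟩
  · have : (i'.coprod (-(m - μ))) (y', z) = i' y' - m z + (2 : ZMod 4) • l (ε z) := by
      simp [μ, sub_eq_add_neg, add_assoc, add_comm]
    rw [map_sub, map_sub] at hw
    rw [this, hmz]
    linear_combination (norm := module) hw + k3
  · have e1 : f (q' (m c)) = 0 := by rw [hm', h.exact₃.apply_apply_eq_zero]
    rw [LinearMap.comp_apply, map_sub, map_sub, e1, map_add, map_add, k4, hw', map_smul, ha]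
    linear_combination (norm := module) -four_smul b

/-- Composable first maps of good triangles fit into an octahedron. -/
lemma exists_octahedron {X₁ X₂ X₃ Z₁₂ Z₂₃ Z₁₃ : FGProj (ZMod 4)}
    {u₁₂ : X₁.obj →ₗ[ZMod 4] X₂.obj} {u₂₃ : X₂.obj →ₗ[ZMod 4] X₃.obj}
    {v₁₂ : X₂.obj →ₗ[ZMod 4] Z₁₂.obj} {w₁₂ : Z₁₂.obj →ₗ[ZMod 4] X₁.obj}
    {v₂₃ : X₃.obj →ₗ[ZMod 4] Z₂₃.obj} {w₂₃ : Z₂₃.obj →ₗ[ZMod 4] X₂.obj}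
    {v₁₃ : X₃.obj →ₗ[ZMod 4] Z₁₃.obj} {w₁₃ : Z₁₃.obj →ₗ[ZMod 4] X₁.obj}
    (h₁₂ : IsGood u₁₂ v₁₂ w₁₂) (h₂₃ : IsGood u₂₃ v₂₃ w₂₃)
    (h₁₃ : IsGood (u₂₃.comp u₁₂) v₁₃ w₁₃) :
    ∃ (m₁ : Z₁₂.obj →ₗ[ZMod 4] Z₁₃.obj) (m₃ : Z₁₃.obj →ₗ[ZMod 4] Z₂₃.obj),
      (∀ x, m₁ (v₁₂ x) = v₁₃ (u₂₃ x)) ∧ (∀ x, w₁₃ (m₁ x) = w₁₂ x) ∧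
      (∀ x, m₃ (v₁₃ x) = v₂₃ x) ∧ (∀ x, u₁₂ (w₁₃ x) = w₂₃ (m₃ x)) ∧
      IsGood m₁ m₃ (v₁₂.comp w₂₃) := by
  obtain ⟨m₁, h1, h2, h3⟩ := exists_isGood_mayerVietoris h₁₂ h₁₃
  -- The first projection composed with `(u₂₃, v₁₂)` is `u₂₃`, so the construction applies again. Up
  -- to signs, the resulting triangle `h6` contains the octahedral one next to a trivial summand on
  -- `X₃`; the rest of the proof removes that summand.
  obtain ⟨m₃, h4, h5, h6⟩ := exists_isGood_mayerVietoris (v := LinearMap.fst _ X₃.obj Z₁₂.obj)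
    h3 (i' := v₂₃) (q' := w₂₃) (by rwa [LinearMap.fst_prod])
  have h7 : ∀ x, m₃ (v₁₃ x) = v₂₃ x := fun x => by simpa using h4 (x, 0)
  have h8 : ∀ x, m₃ (m₁ x) = 0 := fun x => by simpa using h4 (0, x)
  refine ⟨m₁, m₃, h1, h2, h7, fun x => (h5 x).symm, ⟨⟨?_, ?_, ?_⟩, ?_⟩⟩
  · intro z
    constructor
    · intro hz
      obtain ⟨⟨y, w⟩, e⟩ := (h6.exact₁ (0, z)).1 (by simp [hz])
      obtain ⟨e1, e2⟩ := Prod.mk.inj e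
      simp only [LinearMap.fst_apply] at e1
      subst e1
      exact ⟨-w, by simpa using e2⟩
    · rintro ⟨x, rfl⟩
      exact h8 x
  · intro z
    constructor
    · intro hz
      have e1 : (u₂₃.prod v₁₂) (w₂₃ z) = 0 :=
        Prod.ext (h₂₃.exact₃.apply_apply_eq_zero z) hz
      obtain ⟨⟨y, w⟩, e⟩ := (h6.exact₂ z).1 e1
      refine ⟨v₁₃ y - w, ?_⟩
      rw [map_sub, h7, ← e]
      simp [sub_eq_add_neg]
    · rintro ⟨x, rfl⟩
      rw [LinearMap.comp_apply, h5, LinearMap.comp_apply, h₁₂.exact₁.apply_apply_eq_zero]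
  · intro z
    constructor
    · intro hz
      obtain ⟨e, he⟩ := (h6.exact₃ (0, z)).1 (Prod.ext rfl (by simp [hz]))
      exact ⟨e, congrArg Prod.snd he⟩
    · rintro ⟨x, rfl⟩
      have := h6.exact₃.apply_apply_eq_zero x
      have e1 : (u₂₃ (w₂₃ x), v₁₂ (w₂₃ x)) = ((0, v₁₂ (w₂₃ x)) : X₃.obj × Z₁₂.obj) :=
        Prod.ext (h₂₃.exact₃.apply_apply_eq_zero x) rfl
      have e2 := congrArg Prod.snd this
      change (v₁₃.coprod (-m₁)) (u₂₃ (w₂₃ x), v₁₂ (w₂₃ x)) = 0 at e2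
      rw [e1] at e2
      simpa using e2
  · intro z c hzc
    obtain ⟨e, he, he'⟩ := h6.extend (0, z) (0, c) (Prod.ext (by simp) (by
      simp [hzc, neg_two_smul']))
    refine ⟨e, ?_, congrArg Prod.snd he'⟩
    rw [← neg_two_smul', ← he]
    simp

end

/-! ### From linear algebra to triangles in the category -/

section

variable {X Y Z : FGProj (ZMod 4)}

/-- The linear map underlying a morphism. -/
def lin (f : X ⟶ Y) : X.obj →ₗ[ZMod 4] Y.obj := f.hom.hom

/-- The morphism given by a linear map. -/
def homOf (f : X.obj →ₗ[ZMod 4] Y.obj) : X ⟶ Y := ObjectProperty.homMk (ModuleCat.ofHom f)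

@[simp] lemma lin_homOf (f : X.obj →ₗ[ZMod 4] Y.obj) : lin (homOf f) = f := rfl

@[simp] lemma homOf_lin (f : X ⟶ Y) : homOf (lin f) = f := rfl

@[simp] lemma lin_comp (f : X ⟶ Y) (g : Y ⟶ Z) : lin (f ≫ g) = (lin g).comp (lin f) := rfl

@[simp] lemma lin_id : lin (𝟙 X) = LinearMap.id := rfl

lemma lin_two : lin ((2 : ℤ) • 𝟙 X) = LinearMap.lsmul (ZMod 4) X.obj 2 := by
  rw [two_smul]
  ext x
  exact (two_smul (ZMod 4) x).symm

lemma hom_ext_lin {f g : X ⟶ Y} (h : ∀ x, lin f x = lin g x) : f = g := by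
  rw [← homOf_lin f, ← homOf_lin g, LinearMap.ext h]

/-- The isomorphism given by a linear equivalence. -/
def isoOf (e : X.obj ≃ₗ[ZMod 4] Y.obj) : X ≅ Y where
  hom := homOf e.toLinearMap
  inv := homOf e.symm.toLinearMap
  hom_inv_id := hom_ext_lin fun x => e.symm_apply_apply x
  inv_hom_id := hom_ext_lin fun x => e.apply_symm_apply x

/-- The linear equivalence underlying an isomorphism. -/
def equivOf (e : X ≅ Y) : X.obj ≃ₗ[ZMod 4] Y.obj :=
  LinearEquiv.ofLinearMap (lin e.hom) (lin e.inv) (by rw [← lin_comp, e.inv_hom_id, lin_id])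
    (by rw [← lin_comp, e.hom_inv_id, lin_id])

end

section

variable (T T' : Triangle (FGProj (ZMod 4)))

/-- The linear map underlying the third map of a triangle. -/
def lin₃ : T.obj₃.obj →ₗ[ZMod 4] T.obj₁.obj := lin (Y := T.obj₁) T.mor₃

/-- The exact triangles of the triangulated structure. -/
def IsGoodTriangle : Prop := IsGood (lin T.mor₁) (lin T.mor₂) (lin₃ T)

variable {T T'}

lemma comp_mor₁_iff {a : T.obj₁ ⟶ T'.obj₁} {b : T.obj₂ ⟶ T'.obj₂} :
    T.mor₁ ≫ b = a ≫ T'.mor₁ ↔ ∀ x, lin b (lin T.mor₁ x) = lin T'.mor₁ (lin a x) :=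
  ⟨fun h x => LinearMap.congr_fun (congrArg lin h) x, fun h => hom_ext_lin h⟩

lemma comp_mor₂_iff {b : T.obj₂ ⟶ T'.obj₂} {c : T.obj₃ ⟶ T'.obj₃} :
    T.mor₂ ≫ c = b ≫ T'.mor₂ ↔ ∀ x, lin c (lin T.mor₂ x) = lin T'.mor₂ (lin b x) :=
  ⟨fun h x => LinearMap.congr_fun (congrArg lin h) x, fun h => hom_ext_lin h⟩

/-- The shift unfolds definitionally to the identity functor; naming the unshifted object lets the
third maps be read as linear maps into it. -/
lemma comp_mor₃_iff {a : T.obj₁ ⟶ T'.obj₁} {c : T.obj₃ ⟶ T'.obj₃} :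
    T.mor₃ ≫ a⟦(1 : ℤ)⟧' = c ≫ T'.mor₃ ↔ ∀ x, lin a (lin₃ T x) = lin₃ T' (lin c x) :=
  ⟨fun h x => LinearMap.congr_fun (congrArg (lin (Y := T'.obj₁)) h) x,
    fun h => hom_ext_lin (Y := T'.obj₁) h⟩

/-- The isomorphism of triangles given by linear equivalences. -/
def triangleIso (a : T.obj₁.obj ≃ₗ[ZMod 4] T'.obj₁.obj) (b : T.obj₂.obj ≃ₗ[ZMod 4] T'.obj₂.obj)
    (c : T.obj₃.obj ≃ₗ[ZMod 4] T'.obj₃.obj) (h₁ : ∀ x, b (lin T.mor₁ x) = lin T'.mor₁ (a x))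
    (h₂ : ∀ x, c (lin T.mor₂ x) = lin T'.mor₂ (b x)) (h₃ : ∀ x, a (lin₃ T x) = lin₃ T' (c x)) :
    T ≅ T' :=
  Triangle.isoMk _ _ (isoOf a) (isoOf b) (isoOf c) (comp_mor₁_iff.2 h₁) (comp_mor₂_iff.2 h₂)
    (comp_mor₃_iff.2 h₃)

lemma IsGoodTriangle.of_iso (h : IsGoodTriangle T) (e : T ≅ T') : IsGoodTriangle T' :=
  IsGood.of_equiv h (equivOf (Triangle.π₁.mapIso e)) (equivOf (Triangle.π₂.mapIso e))
    (equivOf (Triangle.π₃.mapIso e)) (comp_mor₁_iff.1 e.hom.comm₁) (comp_mor₂_iff.1 e.hom.comm₂)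
    (comp_mor₃_iff.1 e.hom.comm₃)

/-- The contraction is minus the identity from the second object to the first, and zero elsewhere.
-/
lemma isGoodTriangle_contractible (X : FGProj (ZMod 4)) :
    IsGoodTriangle (contractibleTriangle X) :=
  IsGood.of_contraction (fun _ => rfl) (fun _ => rfl) (fun _ => rfl) (-LinearMap.id) 0 0
    (fun b => (add_zero (-b)).symm) (fun c => by
      have hc : c = 0 := LinearMap.congr_fun (congrArg lin
        ((isZero_zero (FGProj (ZMod 4))).eq_of_src (𝟙 (contractibleTriangle X).obj₃) 0)) c
      subst hc
      simp) (fun a => (zero_add (-a)).symm)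

lemma isGoodTriangle_rotate_iff : IsGoodTriangle T.rotate ↔ IsGoodTriangle T :=
  IsGood.rotate_iff (f := lin T.mor₁) (i := lin T.mor₂) (q := lin₃ T)

/-- Morphisms of good triangles can be completed. -/
lemma IsGoodTriangle.exists_fill (h : IsGoodTriangle T) (h' : IsGoodTriangle T')
    (a : T.obj₁ ⟶ T'.obj₁) (b : T.obj₂ ⟶ T'.obj₂) (hab : T.mor₁ ≫ b = a ≫ T'.mor₁) :
    ∃ c : T.obj₃ ⟶ T'.obj₃, T.mor₂ ≫ c = b ≫ T'.mor₂ ∧ T.mor₃ ≫ a⟦(1 : ℤ)⟧' = c ≫ T'.mor₃ := by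
  obtain ⟨c, h1, h2⟩ := IsGood.exists_fill h h' (lin a) (lin b) (comp_mor₁_iff.1 hab)
  exact ⟨homOf c, comp_mor₂_iff.2 h1, comp_mor₃_iff.2 fun x => (h2 x).symm⟩

/-- The five lemma for triangles with the same first morphism. -/
lemma nonempty_iso_of_isQuasiExact {A B C C' : FGProj (ZMod 4)} {f : A ⟶ B} {i : B ⟶ C}
    {q : C ⟶ A⟦(1 : ℤ)⟧} {i' : B ⟶ C'} {q' : C' ⟶ A⟦(1 : ℤ)⟧}
    (h : IsQuasiExact (lin f) (lin i) (lin (Y := A) q))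
    (h' : IsQuasiExact (lin f) (lin i') (lin (Y := A) q')) (c : C ⟶ C') (h₁ : i ≫ c = i')
    (h₂ : c ≫ q' = q) : Nonempty (Triangle.mk f i q ≅ Triangle.mk f i' q') := by
  subst h₁ h₂
  have hc : Function.Bijective (lin c) := h.bijective h' (a := LinearMap.id) (b := LinearMap.id)
    (fun _ => rfl) (fun _ => rfl) (fun _ => rfl) Function.bijective_id Function.bijective_id
  exact ⟨triangleIso (LinearEquiv.refl _ _) (LinearEquiv.refl _ _) (LinearEquiv.ofBijective _ hc)
    (fun _ => rfl) (fun _ => rfl) (fun _ => rfl)⟩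

/-- The pretriangulated structure on the finitely generated projective modules. -/
abbrev pretriangulated : Pretriangulated (FGProj (ZMod 4)) where
  distinguishedTriangles := {T | IsGoodTriangle T}
  isomorphic_distinguished _ h _ e := IsGoodTriangle.of_iso h e.symm
  contractible_distinguished := isGoodTriangle_contractible
  distinguished_cocone_triangle {X Y} f := by
    obtain ⟨Z, i, q, h⟩ := exists_isGood (lin f)
    exact ⟨Z, homOf i, homOf (Y := X) q, h⟩
  rotate_distinguished_triangle _ := isGoodTriangle_rotate_iff.symm
  complete_distinguished_triangle_morphism _ _ h h' a b hab := h.exists_fill h' a b hab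

lemma isTriangulated : @IsTriangulated (FGProj (ZMod 4)) _ _ _ _ _ pretriangulated :=
  letI := pretriangulated
  { octahedron_axiom := by
      rintro X₁ X₂ X₃ Z₁₂ Z₂₃ Z₁₃ u₁₂ u₂₃ _ rfl v₁₂ w₁₂ h₁₂ v₂₃ w₂₃ h₂₃ v₁₃ w₁₃ h₁₃
      obtain ⟨m₁, m₃, h1, h2, h3, h4, h5⟩ := exists_octahedron (u₁₂ := lin u₁₂) (u₂₃ := lin u₂₃)
        (v₁₂ := lin v₁₂) (w₁₂ := lin (Y := X₁) w₁₂) (v₂₃ := lin v₂₃) (w₂₃ := lin (Y := X₂) w₂₃)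
        (v₁₃ := lin v₁₃) (w₁₃ := lin (Y := X₁) w₁₃) h₁₂ h₂₃ h₁₃
      exact ⟨⟨homOf m₁, homOf m₃, hom_ext_lin h1, hom_ext_lin (Y := X₁) h2, hom_ext_lin h3,
        hom_ext_lin (Y := X₂) h4, h5⟩⟩ }

/-! ### Direct sums -/

/-- The direct sum of two triangles on the products of the modules. -/
def prodTriangle (T U : Triangle (FGProj (ZMod 4))) : Triangle (FGProj (ZMod 4)) :=
  Triangle.mk (X := FGProj.of (ZMod 4) (T.obj₁.obj × U.obj₁.obj))
    (Y := FGProj.of (ZMod 4) (T.obj₂.obj × U.obj₂.obj))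
    (Z := FGProj.of (ZMod 4) (T.obj₃.obj × U.obj₃.obj))
    (homOf ((lin T.mor₁).prodMap (lin U.mor₁))) (homOf ((lin T.mor₂).prodMap (lin U.mor₂)))
    (homOf (X := FGProj.of (ZMod 4) (T.obj₃.obj × U.obj₃.obj))
      (Y := FGProj.of (ZMod 4) (T.obj₁.obj × U.obj₁.obj)) ((lin₃ T).prodMap (lin₃ U)))

/-- The product of two modules is their biproduct. -/
def prodIsoBiprod (X Y : FGProj (ZMod 4)) : FGProj.of (ZMod 4) (X.obj × Y.obj) ≅ X ⊞ Y where
  hom := biprod.lift (homOf (X := FGProj.of (ZMod 4) (X.obj × Y.obj)) (LinearMap.fst _ _ _))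
    (homOf (X := FGProj.of (ZMod 4) (X.obj × Y.obj)) (LinearMap.snd _ _ _))
  inv := biprod.desc (homOf (Y := FGProj.of (ZMod 4) (X.obj × Y.obj)) (LinearMap.inl _ _ _))
    (homOf (Y := FGProj.of (ZMod 4) (X.obj × Y.obj)) (LinearMap.inr _ _ _))
  hom_inv_id := by
    rw [biprod.lift_desc]
    exact hom_ext_lin fun x => Prod.fst_add_snd x
  inv_hom_id := by
    apply biprod.hom_ext'
    · apply biprod.hom_ext
      · simp; rfl
      · simp; rfl
    · apply biprod.hom_ext
      · simp; rfl
      · simp; rfl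

lemma prodIsoBiprod_naturality {X Y X' Y' : FGProj (ZMod 4)} (f : X ⟶ X') (g : Y ⟶ Y') :
    homOf (X := FGProj.of (ZMod 4) (X.obj × Y.obj)) (Y := FGProj.of (ZMod 4) (X'.obj × Y'.obj))
      ((lin f).prodMap (lin g)) ≫ (prodIsoBiprod X' Y').hom =
      (prodIsoBiprod X Y).hom ≫ biprod.map f g := by
  apply biprod.hom_ext
  · simp [prodIsoBiprod]; rfl
  · simp [prodIsoBiprod]; rfl

/-- The direct sum of triangles can be computed with products. -/
def prodTriangleIso (T T' : Triangle (FGProj (ZMod 4))) :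
    prodTriangle T T' ≅ TriangleTheory.directSum T T' :=
  Triangle.isoMk _ _ (prodIsoBiprod T.obj₁ T'.obj₁) (prodIsoBiprod T.obj₂ T'.obj₂)
    (prodIsoBiprod T.obj₃ T'.obj₃)
    (prodIsoBiprod_naturality _ _) (prodIsoBiprod_naturality _ _) (by
      have h1 := prodIsoBiprod_naturality (X' := T.obj₁) (Y' := T'.obj₁) T.mor₃ T'.mor₃
      have h2 : biprod.map (Y := T.obj₁) (Z := T'.obj₁) T.mor₃ T'.mor₃ = biprod.desc
        (biprod.inl ≫ biprod.map T.mor₃ T'.mor₃) (biprod.inr ≫ biprod.map T.mor₃ T'.mor₃) := by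
        apply biprod.hom_ext' <;> simp <;> rfl
      rw [biprod.inl_map, biprod.inr_map] at h2
      rw [h2] at h1
      exact h1)

lemma IsGoodTriangle.directSum (h : IsGoodTriangle T) (h' : IsGoodTriangle T') :
    IsGoodTriangle (TriangleTheory.directSum T T') := by
  have : IsGoodTriangle (prodTriangle T T') := IsGood.prodMap h h'
  exact this.of_iso (prodTriangleIso T T')

lemma isGoodTriangle_twoTriangle (X : FGProj (ZMod 4)) :
    IsGoodTriangle (FGProj.twoTriangle X) := by
  have h : IsGood (lin ((2 : ℤ) • 𝟙 X)) (lin ((2 : ℤ) • 𝟙 X)) (lin ((2 : ℤ) • 𝟙 X)) := by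
    rw [lin_two]
    exact isGood_two
  exact h

lemma isGoodTriangle_of_isContractible (h : TriangleTheory.IsContractible T) :
    IsGoodTriangle T := by
  obtain ⟨⟨h1, h2, h3⟩, α₁, α₂, α₀, hB, hC, hA⟩ := h
  refine IsGood.of_contraction (fun x => ?_) (fun x => ?_) (fun x => ?_) (lin α₁) (lin α₂)
    (lin (X := T.obj₁) α₀) (fun x => ?_) (fun x => ?_) (fun x => ?_)
  · exact LinearMap.congr_fun (congrArg lin h1) x
  · exact LinearMap.congr_fun (congrArg (lin (Y := T.obj₁)) h2) x
  · exact LinearMap.congr_fun (congrArg (lin (Y := T.obj₂)) h3) x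
  · exact (add_zero _).symm.trans (LinearMap.congr_fun (congrArg lin hB) x)
  · exact (add_zero _).symm.trans (LinearMap.congr_fun (congrArg lin hC) x)
  · exact (add_zero _).symm.trans
      (LinearMap.congr_fun (congrArg (lin (X := T.obj₁) (Y := T.obj₁)) hA) x)

/-- The contractible triangle on three modules. -/
def contrTriangle (P S S' : FGProj (ZMod 4)) : Triangle (FGProj (ZMod 4)) :=
  Triangle.mk (X := FGProj.of (ZMod 4) (P.obj × S.obj))
    (Y := FGProj.of (ZMod 4) (P.obj × S'.obj)) (Z := FGProj.of (ZMod 4) (S'.obj × S.obj))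
    (homOf (contr₁ P.obj S.obj S'.obj)) (homOf (contr₂ P.obj S.obj S'.obj))
    (homOf (X := FGProj.of (ZMod 4) (S'.obj × S.obj)) (Y := FGProj.of (ZMod 4) (P.obj × S.obj))
      (contr₃ P.obj S.obj S'.obj))

lemma isContractible_contrTriangle (P S S' : FGProj (ZMod 4)) :
    TriangleTheory.IsContractible (contrTriangle P S S') := by
  have h := isGood_contr P.obj S.obj S'.obj
  obtain ⟨hB, hC, hA⟩ := contr_contraction P.obj S.obj S'.obj
  refine ⟨⟨hom_ext_lin h.exact₁.apply_apply_eq_zero,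
    hom_ext_lin (Y := (contrTriangle P S S').obj₁) h.exact₂.apply_apply_eq_zero,
    hom_ext_lin (Y := (contrTriangle P S S').obj₂) h.exact₃.apply_apply_eq_zero⟩,
    homOf (X := (contrTriangle P S S').obj₂) (Y := (contrTriangle P S S').obj₁)
      (-contr₁ P.obj S'.obj S.obj),
    homOf (X := (contrTriangle P S S').obj₃) (Y := (contrTriangle P S S').obj₂)
      (contrHomotopy₂ P.obj S.obj S'.obj),
    homOf (X := (contrTriangle P S S').obj₁) (Y := (contrTriangle P S S').obj₃)
      (contrHomotopy₀ P.obj S.obj S'.obj), ?_, ?_, ?_⟩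
  · exact hom_ext_lin fun x => (add_zero _).trans (hB x)
  · exact hom_ext_lin fun x => (add_zero _).trans (hC x)
  · exact hom_ext_lin (X := (contrTriangle P S S').obj₁) (Y := (contrTriangle P S S').obj₁)
      fun x => (add_zero _).trans (hA x)

lemma isGoodTriangle_iff : IsGoodTriangle T ↔
    ∃ (K : Triangle (FGProj (ZMod 4))) (X : FGProj (ZMod 4)),
      TriangleTheory.IsContractible K ∧
      Nonempty (T ≅ TriangleTheory.directSum K (FGProj.twoTriangle X)) := by
  constructor
  · intro h
    obtain ⟨P, S, S', Q, a, b, c, h1, h2, h3⟩ := IsGood.exists_equiv_normal h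
    refine ⟨contrTriangle P S S', Q, isContractible_contrTriangle P S S',
      ⟨Iso.symm ?_ ≪≫ prodTriangleIso _ _⟩⟩
    refine triangleIso a b c (fun x => ?_) (fun x => ?_) (fun x => ?_)
    · refine Eq.trans ?_ (h1 x)
      exact congrArg b (Prod.ext rfl (LinearMap.congr_fun lin_two x.2))
    · refine Eq.trans ?_ (h2 x)
      exact congrArg c (Prod.ext rfl (LinearMap.congr_fun lin_two x.2))
    · refine Eq.trans ?_ (h3 x).symm
      exact congrArg a (Prod.ext rfl (LinearMap.congr_fun lin_two x.2))
  · rintro ⟨K, X, hK, ⟨e⟩⟩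
    exact ((isGoodTriangle_of_isContractible hK).directSum
      (isGoodTriangle_twoTriangle X)).of_iso e.symm

end

/-! ### Uniqueness of the pretriangulated structure -/

section

/-- The morphism from the unit given by an element. -/
def elem {X : FGProj (ZMod 4)} (x : X.obj) : FGProj.unit (ZMod 4) ⟶ X :=
  homOf (X := FGProj.unit (ZMod 4)) (LinearMap.toSpanSingleton (ZMod 4) X.obj x)

/-- The value of a morphism from the unit at the generator. -/
def evalOne {X : FGProj (ZMod 4)} (f : FGProj.unit (ZMod 4) ⟶ X) : X.obj :=
  lin f (1 : ZMod 4)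

lemma evalOne_elem {X : FGProj (ZMod 4)} (x : X.obj) : evalOne (elem x) = x :=
  one_smul _ x

lemma hom_unit_ext {X : FGProj (ZMod 4)} {f g : FGProj.unit (ZMod 4) ⟶ X}
    (h : evalOne f = evalOne g) : f = g := by
  have : lin f = lin g := LinearMap.ext_ring (R := ZMod 4) h
  rw [← homOf_lin f, ← homOf_lin g, this]

variable [Pretriangulated (FGProj (ZMod 4))] {T : Triangle (FGProj (ZMod 4))}

/-- The unit represents the underlying module, so exactness of its Hom functor on a distinguished
triangle is exactness of modules. -/
lemma exact_of_distinguished (hT : T ∈ distTriang (FGProj (ZMod 4))) :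
    Function.Exact (lin T.mor₁) (lin T.mor₂) := by
  intro y
  constructor
  · intro hy
    obtain ⟨g, hg⟩ := Triangle.coyoneda_exact₂ T hT (elem y) (hom_unit_ext (by
      change lin T.mor₂ (evalOne (elem y)) = 0
      rw [evalOne_elem, hy]))
    refine ⟨evalOne g, ?_⟩
    have := congrArg evalOne hg
    rw [evalOne_elem] at this
    exact this.symm
  · rintro ⟨x, rfl⟩
    exact LinearMap.congr_fun (congrArg lin (comp_distTriang_mor_zero₁₂ T hT)) x

lemma isQuasiExact_of_distinguished (hT : T ∈ distTriang (FGProj (ZMod 4))) :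
    IsQuasiExact (lin T.mor₁) (lin T.mor₂) (lin₃ T) where
  exact₁ := exact_of_distinguished hT
  exact₂ := exact_of_distinguished (rot_of_distTriang _ hT)
  exact₃ := by
    have h : Function.Exact (lin₃ T) (-lin T.mor₁) :=
      exact_of_distinguished (rot_of_distTriang _ (rot_of_distTriang _ hT))
    intro y
    rw [← h y]
    simp

/-- The triangle of multiplications by `2` is exact in every pretriangulated structure. -/
lemma twoTriangle_unit_distinguished :
    FGProj.twoTriangle (FGProj.unit (ZMod 4)) ∈ distTriang (FGProj (ZMod 4)) := by
  obtain ⟨C, i, q, hT⟩ := distinguished_cocone_triangle ((2 : ℤ) • 𝟙 (FGProj.unit (ZMod 4)))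
  have hq := isQuasiExact_of_distinguished hT
  let R : Type := (FGProj.unit (ZMod 4)).obj
  let one : R := (1 : ZMod 4)
  let i' : R →ₗ[ZMod 4] C.obj := lin i
  let q' : C.obj →ₗ[ZMod 4] R := lin (Y := FGProj.unit (ZMod 4)) q
  have hfi : Function.Exact (LinearMap.lsmul (ZMod 4) R 2) i' := by
    have := hq.exact₁
    change Function.Exact (lin ((2 : ℤ) • 𝟙 (FGProj.unit (ZMod 4)))) i' at this
    rwa [lin_two] at this
  have hiq : Function.Exact i' q' := hq.exact₂
  -- Since 2 kills `i 1`, one has `i 1 = 2 c`. Exactness and `i 1 ≠ 0` force `q c` to be the nonzero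
  -- element of `ZMod 4` killed by 2, namely 2. So `c` defines a comparison from the triangle of 2s,
  -- and the five lemma applies.
  obtain ⟨c, hc⟩ := exists_eq_two_smul (c := i' one) (by
    rw [← map_smul]
    exact hfi.apply_apply_eq_zero one)
  have hne : i' one ≠ 0 := fun h => by
    obtain ⟨x, hx⟩ := (hfi one).1 h
    have key : ∀ x : ZMod 4, 2 * x ≠ 1 := by decide
    exact key x hx
  have hqc : q' c = (2 : ZMod 4) • one := by
    have h1 : (2 : ZMod 4) • q' c = 0 := by
      rw [← map_smul, ← hc, hiq.apply_apply_eq_zero]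
    have h2 : q' c ≠ 0 := fun h => by
      obtain ⟨r, hr⟩ := (hiq c).1 h
      apply hne
      rw [hc, ← hr, ← map_smul]
      exact hfi.apply_apply_eq_zero r
    have key : ∀ x : ZMod 4, 2 * x = 0 → x ≠ 0 → x = 2 * 1 := by decide
    exact key _ h1 h2
  have hTwo : IsQuasiExact (lin ((2 : ℤ) • 𝟙 (FGProj.unit (ZMod 4))))
      (lin ((2 : ℤ) • 𝟙 (FGProj.unit (ZMod 4)))) (lin ((2 : ℤ) • 𝟙 (FGProj.unit (ZMod 4)))) :=
    (isGoodTriangle_twoTriangle (FGProj.unit (ZMod 4))).toIsQuasiExact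
  obtain ⟨e⟩ := nonempty_iso_of_isQuasiExact hTwo hq (elem c)
    (hom_unit_ext (by
      change lin (elem c) (lin ((2 : ℤ) • 𝟙 (FGProj.unit (ZMod 4))) one) = i' one
      rw [lin_two, hc]
      exact (map_smul (lin (elem c)) 2 one).trans (congrArg _ (evalOne_elem c))))
    (hom_unit_ext (X := FGProj.unit (ZMod 4)) (by
      change q' (evalOne (elem c)) = lin ((2 : ℤ) • 𝟙 (FGProj.unit (ZMod 4))) one
      rw [lin_two, evalOne_elem, hqc]
      rfl))
  exact isomorphic_distinguished _ hT _ e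

lemma isGoodTriangle_of_distinguished (hT : T ∈ distTriang (FGProj (ZMod 4))) :
    IsGoodTriangle T where
  toIsQuasiExact := isQuasiExact_of_distinguished hT
  extend x y hxy := by
    let T₀ := FGProj.twoTriangle (FGProj.unit (ZMod 4))
    obtain ⟨c, h1, h2⟩ := complete_distinguished_triangle_morphism T₀ T
      twoTriangle_unit_distinguished hT (elem x) (elem y) (hom_unit_ext (by
        change lin (elem y) (lin ((2 : ℤ) • 𝟙 (FGProj.unit (ZMod 4))) (1 : ZMod 4)) =
          lin T.mor₁ (evalOne (elem x))
        rw [lin_two, evalOne_elem, hxy]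
        exact (map_smul (lin (elem y)) 2 _).trans (congrArg _ (evalOne_elem y))))
    refine ⟨evalOne c, ?_, ?_⟩
    · have h3 : lin c (lin ((2 : ℤ) • 𝟙 (FGProj.unit (ZMod 4))) (1 : ZMod 4)) =
          lin T.mor₂ (evalOne (elem y)) := congrArg evalOne h1
      rw [lin_two, evalOne_elem] at h3
      exact h3.symm.trans (map_smul (lin c) 2 _)
    · have h3 : lin (elem x) (lin ((2 : ℤ) • 𝟙 (FGProj.unit (ZMod 4))) (1 : ZMod 4)) =
          lin₃ T (evalOne c) := congrArg (evalOne (X := T.obj₁)) h2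
      rw [lin_two] at h3
      exact h3.symm.trans ((map_smul (lin (elem x)) 2 _).trans (congrArg _ (evalOne_elem x)))

lemma distinguished_iff : T ∈ distTriang (FGProj (ZMod 4)) ↔ IsGoodTriangle T := by
  refine ⟨isGoodTriangle_of_distinguished, fun h => ?_⟩
  obtain ⟨C, i, q, hD⟩ := distinguished_cocone_triangle T.mor₁
  have hD' := isGoodTriangle_of_distinguished hD
  obtain ⟨c, h1, h2⟩ := h.exists_fill hD' (𝟙 T.obj₁) (𝟙 T.obj₂)
    ((Category.comp_id _).trans (Category.id_comp _).symm)
  obtain ⟨e⟩ := nonempty_iso_of_isQuasiExact (A := T.obj₁) (q := T.mor₃) (q' := q)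
    h.toIsQuasiExact hD'.toIsQuasiExact c
    (h1.trans (Category.id_comp _)) (h2.symm.trans (Category.comp_id (Y := T.obj₁) _))
  exact isomorphic_distinguished _ hD _ e

end

/-- The class of distinguished triangles is the only datum of a pretriangulated structure; the other
fields are propositions. -/
lemma eq_pretriangulated (P : Pretriangulated (FGProj (ZMod 4))) : P = pretriangulated := by
  have h : P.distinguishedTriangles = pretriangulated.distinguishedTriangles :=
    Set.ext fun T => distinguished_iff
  cases P
  cases h
  rfl

end ZModFour

/-! ### Cones of multiplication by 2 in stable categories, and non-algebraicity -/

namespace FrobeniusStructure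

variable {E : Type u} [Category.{v} E] [Preadditive E] [HasZeroObject E] [HasBinaryBiproducts E]
  (S : FrobeniusStructure E)

instance : S.toStable.Additive where
  map_add := rfl

lemma toStable_map_eq_zero_iff {X Y : E} (f : X ⟶ Y) :
    S.toStable.map f = 0 ↔ ∃ (J : E) (_ : S.IsInjective J) (p : X ⟶ J) (q : J ⟶ Y), f = p ≫ q := by
  rw [← S.toStable.map_zero, CategoryTheory.Quotient.functor_map_eq_iff]
  simp [stableRel]

/-- The cone of multiplication by `2` on an object of a Frobenius category: it is killed by `2` in
the stable category, and a morphism that is killed by `2` factors through it. -/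
lemma exists_cone_two (X : E) : ∃ (Z : E) (g : X ⟶ Z),
    S.toStable.map (𝟙 Z + 𝟙 Z) = 0 ∧ ∀ (y : X ⟶ X), S.toStable.map (y + y) = 0 →
      ∃ l : Z ⟶ X, g ≫ l = y := by
  have hι : IsInflation S.IsConflation (S.ι X) := ⟨_, _, _, S.conflation_ι_π X⟩
  obtain ⟨Z, j, g, h, -⟩ := S.pushout (S.ι X) (𝟙 X + 𝟙 X) hι
  have hw : S.ι X ≫ j = g + g := by
    rw [h.w, Preadditive.add_comp, Category.id_comp]
  refine ⟨Z, g, ?_, fun y hy => ?_⟩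
  · rw [toStable_map_eq_zero_iff]
    -- Twice the identity of `Z` factors as `Z ⟶ hull X ⟶ Z`: on `hull X` it is `2 j`, and on `X` it
    -- is `ι ≫ j = 2 g`, by the pushout square.
    refine ⟨S.hull X, S.injective_hull X, h.desc (𝟙 _ + 𝟙 _) (S.ι X) (by simp), j, ?_⟩
    apply h.hom_ext
    · simp
    · simp [hw]
  · rw [toStable_map_eq_zero_iff] at hy
    obtain ⟨J, hJ, p, q, hpq⟩ := hy
    obtain ⟨r, hr⟩ := hJ _ (S.conflation_ι_π X) p
    have hr' : S.ι X ≫ r = p := hr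
    -- `2 y` factors through an injective, so it extends along `ι` to `r ≫ q`; this and `y` agree on
    -- `X` and glue on the pushout.
    exact ⟨h.desc (r ≫ q) y (by rw [← Category.assoc, hr', ← hpq]; simp), h.inr_desc _ _ _⟩

end FrobeniusStructure

namespace ZModFour

lemma id_add_id_eq_zero {G : FGProj (ZMod 4)} (h : 𝟙 G + 𝟙 G = 0) : 𝟙 G = 0 := by
  have h2 : ∀ x : G.obj, (2 : ZMod 4) • x = 0 := fun x =>
    (two_smul _ x).trans (LinearMap.congr_fun (congrArg lin h) x)
  refine hom_ext_lin fun x => ?_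
  obtain ⟨y, hy⟩ := exists_eq_two_smul (h2 x)
  exact hy.trans (h2 y)

lemma id_add_id_unit_ne_zero : 𝟙 (FGProj.unit (ZMod 4)) + 𝟙 (FGProj.unit (ZMod 4)) ≠ 0 := by
  intro h
  have h1 : (1 + 1 : ZMod 4) = 0 := congrArg evalOne h
  exact absurd h1 (by decide)

/-- There is no additive equivalence to the stable category of a Frobenius category. -/
lemma isEmpty_equivalence_stable {E : Type u} [Category.{v} E] [Preadditive E] [HasZeroObject E]
    [HasBinaryBiproducts E] (S : FrobeniusStructure E) (F : FGProj (ZMod 4) ≌ S.Stable)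
    [F.functor.Additive] : False := by
  obtain ⟨X, hX⟩ : ∃ X : E, S.toStable.obj X = F.functor.obj (FGProj.unit (ZMod 4)) :=
    ⟨(F.functor.obj (FGProj.unit (ZMod 4))).as, rfl⟩
  obtain ⟨Z, g, h1, h2⟩ := S.exists_cone_two X
  let e := F.counitIso.app (S.toStable.obj Z)
  have hid : 𝟙 (S.toStable.obj Z) = 0 := by
    have hG : 𝟙 (F.inverse.obj (S.toStable.obj Z)) = 0 := by
      apply id_add_id_eq_zero
      apply F.functor.map_injective
      rw [F.functor.map_add, F.functor.map_zero, F.functor.map_id]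
      rw [S.toStable.map_add, S.toStable.map_id] at h1
      have h3 : 𝟙 (F.functor.obj (F.inverse.obj (S.toStable.obj Z))) = e.hom ≫ 𝟙 _ ≫ e.inv := by
        simp
      rw [h3, ← Preadditive.comp_add, ← Preadditive.add_comp]
      exact (congrArg (fun t => e.hom ≫ t ≫ e.inv) h1).trans (by simp)
    have h4 := congrArg F.functor.map hG
    rw [F.functor.map_id, F.functor.map_zero] at h4
    have h5 : 𝟙 (S.toStable.obj Z) = e.inv ≫ 𝟙 _ ≫ e.hom := by simp
    rw [h5]
    exact (congrArg (fun t => e.inv ≫ t ≫ e.hom) h4).trans (by simp)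
  -- The morphism to be factored through the cone is 2 itself, which is killed by 2 because 4 = 0.
  have hfour : S.toStable.map ((𝟙 X + 𝟙 X) + (𝟙 X + 𝟙 X)) = 0 := by
    have h6 : (𝟙 (FGProj.unit (ZMod 4)) + 𝟙 (FGProj.unit (ZMod 4))) +
        (𝟙 (FGProj.unit (ZMod 4)) + 𝟙 (FGProj.unit (ZMod 4))) = 0 := hom_unit_ext rfl
    have h7 := congrArg F.functor.map h6
    rw [F.functor.map_add, F.functor.map_add, F.functor.map_id, F.functor.map_zero, ← hX] at h7
    rw [S.toStable.map_add, S.toStable.map_add, S.toStable.map_id]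
    exact h7
  obtain ⟨l, hl⟩ := h2 _ hfour
  apply id_add_id_unit_ne_zero
  apply F.functor.map_injective
  rw [F.functor.map_add, F.functor.map_id, F.functor.map_zero, ← hX, ← S.toStable.map_id,
    ← S.toStable.map_add, ← hl, S.toStable.map_comp, ← Category.comp_id (S.toStable.map g), hid]
  simp

end ZModFour

end

theorem mainTheorem2 :
    ∃ P : Pretriangulated (FGProj (ZMod 4)),
      IsTriangulated (FGProj (ZMod 4)) ∧
      (∀ P' : Pretriangulated (FGProj (ZMod 4)), P' = P) ∧
      (∀ T : Triangle (FGProj (ZMod 4)),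
        T ∈ P.distinguishedTriangles ↔
          ∃ (K : Triangle (FGProj (ZMod 4))) (X : FGProj (ZMod 4)),
            TriangleTheory.IsContractible K ∧
            Nonempty (T ≅ TriangleTheory.directSum K (FGProj.twoTriangle X))) ∧
      FGProj.twoTriangle (FGProj.unit (ZMod 4)) ∈ P.distinguishedTriangles ∧
      ¬ IsAlgebraicTriangulated.{0, 1, v, u} (FGProj (ZMod 4)) := by
  refine ⟨ZModFour.pretriangulated, ZModFour.isTriangulated, ZModFour.eq_pretriangulated,
    fun T => ZModFour.isGoodTriangle_iff, ZModFour.isGoodTriangle_twoTriangle _, ?_⟩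
  rintro ⟨E, _, _, _, _, S, F, φ, hF, -⟩
  exact ZModFour.isEmpty_equivalence_stable S F
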